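/- **Setting.** All attribute domains are standard Borel spaces and variables are sorted (all positions of a variable have the same domain). Let $\mathcal E$ and $\mathcal I$ be finite relational schemas (extensional and intensional) with disjoint relation symbols. A *fact* is an expression $R(u_1,\dots,u_n)$ with $u_i$ in the $i$-th attribute domain of $R$; the set of facts carries the disjoint union of the product $\sigma$-algebras. An *instance* is a finite set of facts. Spaces of instances carry the $\sigma$-algebra generated by the counting events $\{D : |D\cap F|=n\}$, with $F$ a measurable set of facts and $n\in\mathbb N$. A *sub-probabilistic database* is a sub-probability measure on a space of instances. A *parameterized distribution* $\psi$ has a parameter space $\Pi_\psi=\Pi_1\times\dots\times\Pi_m$, $m>0$, with attribute domains as factors, a standard Borel space $W_\psi$ with a $\sigma$-finite measure $\mu_\psi$ (for example a countable set with the counting measure, or $\mathbb R^n$ with Lebesgue measure), and a probability density $\psi\langle p\rangle$ with respect to $\mu_\psi$ for every $p\in\Pi_\psi$. We assume that $p\mapsto\psi\langle p\rangle(w)$ is continuous for every $w\in W_\psi$, with respect to some separable metrizable topology on $\Pi_\psi$ whose Borel sets are the measurable sets. A *GDatalog program* $\mathcal G$ is a finite bag of rules. A deterministic rule is $R(\bar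 u)\leftarrow\beta$ and a probabilistic rule is $R(\bar u,\psi\langle\bar p\rangle)\leftarrow\beta$, where $R\in\mathcal I$, the body $\beta$ is a finite conjunction of atoms over $\mathcal E\cup\mathcal I$, and $\bar u,\bar p$ consist of constants and of variables that occur in $\beta$; $W_\psi$ is included, measurably, in the domain of the attribute of $R$ at which $\psi\langle \bar p\rangle$ stands (which may be any attribute). The *existential version* $\mathcal G^\exists$ is the bag obtained by replacing the $i$-th rule, if it is probabilistic, by the two rules $$\exists z\, R_i(\bar u,\bar p,z)\leftarrow\beta\qquad\text{and}\qquad R(\bar u,z)\leftarrow R_i(\bar u,\bar p,z),$$ with a new relation symbol $R_i$. Let $\mathbb D$ be the space of instances over $\mathcal E\cup\mathcal I$ and the symbols $R_i$, and let $\mathbb D_{\mathrm{in}}\subseteq\mathbb D$ be the set of instances over $\mathcal E$. For $D\in\mathbb D$ let $\mathrm{App}(D)$ be the (finite) set of pairs $(\varphi,a)$ such that $\varphi$ is a rule of $\mathcal G^\exists$ and, for some valuation of the variables of $\varphi$ that induces the head grounding $a$ (without the value of $z$), the body of $\varphi$ holds in $D$ and its head does not. In a *parallel chase step* from $D$ with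 $\mathrm{App}(D)\ne\emptyset$, every pair $(\varphi,a)\in\mathrm{App}(D)$ fires: if $\varphi$ is existential, a value $z$ is sampled from $\psi\langle p\rangle$, where $\psi$ is the parameterized distribution of the rule and $p$ is the parameter part of $a$, all samples being independent; and the resulting facts are added to $D$. Let $\kappa(D,\cdot)$ be the distribution of the resulting instance, and write $D\Vdash D'$ if $D'$ arises from $D$ for some sample outcomes. If $\mathrm{App}(D)=\emptyset$, let $\kappa(D,\cdot)$ be the Dirac measure at $D$, and $D\Vdash D'$ if and only if $D'=D$. A *path* is a sequence $(D_n)_{n\in\mathbb N}$ in $\mathbb D$ with $D_n\Vdash D_{n+1}$ for all $n$. Let $\lim:\mathbb D^{\mathbb N}\to\mathbb D\uplus\{\bot\}$ map a path with $D_j=D_i$ for all $j>i$ to $D_i$, and everything else to $\bot$; let $\lim_{D_{\mathrm{in}}}$ be defined likewise, with only the paths with $D_0=D_{\mathrm{in}}$. **Theorem.** The map $\kappa$ is a stochastic kernel on $\mathbb D$, and $\lim$ and $\lim_{D_{\mathrm{in}}}$ (for all $D_{\mathrm{in}}\in\mathbb D_{\mathrm{in}}$) are measurable. Moreover: 1.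 For every $D_{\mathrm{in}}\in\mathbb D_{\mathrm{in}}$ there is exactly one measure $Q$ on $\mathbb D^{\mathbb N}$ that is the law of a Markov process with initial distribution $\delta_{D_{\mathrm{in}}}$ and transition kernel $\kappa$, and the restriction of $Q\circ\lim_{D_{\mathrm{in}}}^{-1}$ to $\mathbb D$ is a sub-probabilistic database, the output $\mathcal G_{\mathrm{App}}(D_{\mathrm{in}})$. 2. For every sub-probability measure $P$ on $\mathbb D_{\mathrm{in}}$ there is exactly one measure $Q$ on $\mathbb D^{\mathbb N}$ that is the law of a Markov process with initial distribution $P$ (regarded as a measure on $\mathbb D$) and transition kernel $\kappa$, and the restriction of $Q\circ\lim^{-1}$ to $\mathbb D$ is a sub-probabilistic database, the output $\mathcal G_{\mathrm{App}}(P)$. -/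

import Mathlib

open MeasureTheory
open scoped ENNReal NNReal

universe u v w

noncomputable section

namespace GDatalog

/-! ## Relational databases -/

/-- A relational schema over a set `S` of sorts: finitely many relation symbols, each with finitely
many attributes (their number is the arity), every attribute with a sort. The domain of an
attribute of sort `s` is the carrier `Dom s`; attributes with the same sort have equal domains. -/
structure Schema (S : Type u) where
  Rel : Type
  Attr : Rel → Type
  sort : (R : Rel) → Attr R → S
  [finiteRel : Finite Rel]
  [finiteAttr : ∀ R, Finite (Attr R)]

attribute [instance] Schema.finiteRel Schema.finiteAttr

section Databases

variable {S : Type u} (σ : Schema S) (Dom : S → Type v)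

/-- Facts `R(u₁, …, uₙ)`, where `uᵢ` is in the domain of the `i`-th attribute. For measurable
attribute domains this type carries the disjoint union of the product `σ`-algebras. -/
abbrev Fact : Type v := Σ R : σ.Rel, ∀ a : σ.Attr R, Dom (σ.sort R a)

/-- Database instances under set semantics: finite sets of facts. -/
@[ext]
structure DB where
  facts : Finset (Fact σ Dom)

instance : Membership (Fact σ Dom) (DB σ Dom) := ⟨fun D f => f ∈ D.facts⟩

/-- The `σ`-algebra on instances, generated by the counting events
`{D | D contains exactly n facts from F}` for measurable `F`. -/
instance [∀ s, MeasurableSpace (Dom s)] : MeasurableSpace (DB σ Dom) :=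
  MeasurableSpace.generateFrom
    {s | ∃ (F : Set (Fact σ Dom)) (n : ℕ), MeasurableSet F ∧
      s = {D : DB σ Dom | Set.ncard {f | f ∈ D ∧ f ∈ F} = n}}

end Databases

/-! ## Terms, atoms and rule bodies -/

section Rules

variable {S : Type u} {Dom : S → Type v}

/-- Deterministic terms of sort `s`: variables of that sort and constants from its domain. -/
inductive Term (Dom : S → Type v) {Var : Type} (vs : Var → S) : S → Type (max u v)
  | var (x : Var) : Term Dom vs (vs x)
  | const {s : S} (c : Dom s) : Term Dom vs s

namespace Term

variable {Var : Type} {vs : Var → S}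

/-- The value of a term under a valuation of the variables. -/
def eval (α : ∀ x, Dom (vs x)) : ∀ {s : S}, Term Dom vs s → Dom s
  | _, .var x => α x
  | _, .const c => c

/-- The term is the variable `x`. -/
def IsVar (x : Var) : ∀ {s : S}, Term Dom vs s → Prop
  | _, .var y => y = x
  | _, .const _ => False

theorem eval_of_isVar (α : ∀ x, Dom (vs x)) {x : Var} {s : S} (t : Term Dom vs s)
    (h : t.IsVar x) : ∃ e : s = vs x, e ▸ t.eval α = α x := by
  cases t with
  | var y => cases h; exact ⟨rfl, rfl⟩
  | const c => exact h.elim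

/-- A term all of whose variables satisfy `Q`, as a term over these variables and one additional
variable `none` of sort `s₀`. -/
def restrict (Q : Var → Prop) (s₀ : S) : ∀ {s : S} (t : Term Dom vs s), (∀ x, t.IsVar x → Q x) →
    Term Dom (fun o : Option {x // Q x} => o.elim s₀ fun x => vs x) s
  | _, .var x, h => Term.var (vs := fun o : Option {x // Q x} => o.elim s₀ fun x => vs x)
      (some (Subtype.mk x (h x rfl)))
  | _, .const c, _ => .const c

theorem restrict_isVar {Q : Var → Prop} {s₀ s : S} (t : Term Dom vs s)
    (h : ∀ x, t.IsVar x → Q x) (x : {x // Q x}) (hx : t.IsVar x.1) :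
    (t.restrict Q s₀ h).IsVar (some x) := by
  cases t with
  | var y =>
    obtain ⟨x, hq⟩ := x
    cases hx
    rfl
  | const c => exact hx.elim

end Term

/-- Deterministic atoms `R(t₁, …, tₙ)`. -/
structure Atom (σ : Schema S) (Dom : S → Type v) {Var : Type} (vs : Var → S) where
  rel : σ.Rel
  args : ∀ a : σ.Attr rel, Term Dom vs (σ.sort rel a)

/-- The fact obtained from an atom by a valuation. -/
def Atom.ground {σ : Schema S} {Var : Type} {vs : Var → S} (A : Atom σ Dom vs)
    (α : ∀ x, Dom (vs x)) : Fact σ Dom :=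
  ⟨A.rel, fun a => (A.args a).eval α⟩

/-- Rule bodies: finite conjunctions of deterministic atoms, together with the (sorted) variables
of the rule, all of which occur in the body. -/
structure Body (σ : Schema S) (Dom : S → Type v) where
  Var : Type
  [finiteVar : Finite Var]
  vs : Var → S
  atoms : List (Atom σ Dom vs)
  occurs : ∀ x, ∃ A ∈ atoms, ∃ a, (A.args a).IsVar x

attribute [instance] Body.finiteVar

/-- Valuations of the variables of a rule. -/
abbrev Body.Val {σ : Schema S} (β : Body σ Dom) : Type v := ∀ x, Dom (β.vs x)

/-- `D ⊨ β(α)`. -/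
def Body.Holds {σ : Schema S} (β : Body σ Dom) (D : DB σ Dom) (α : β.Val) : Prop :=
  ∀ A ∈ β.atoms, A.ground α ∈ D

theorem Body.finite_holds {σ : Schema S} (β : Body σ Dom) (D : DB σ Dom) :
    {α : β.Val | β.Holds D α}.Finite := by
  let adom : ∀ s : S, Set (Dom s) := fun s =>
    ⋃ f ∈ D.facts, ⋃ a : σ.Attr f.1,
      {x | ∃ e : σ.sort f.1 a = s, e ▸ f.2 a = x}
  have hfin : ∀ s, (adom s).Finite := by
    intro s
    refine Set.Finite.biUnion (Finset.finite_toSet _) fun f _ => Set.finite_iUnion fun a => ?_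
    refine Set.Subsingleton.finite ?_
    rintro x ⟨e, rfl⟩ y ⟨e', rfl⟩
    rfl
  refine (Set.Finite.pi' fun x => hfin (β.vs x)).subset ?_
  intro α hα x
  obtain ⟨A, hA, a, ha⟩ := β.occurs x
  obtain ⟨e, he⟩ := Term.eval_of_isVar α _ ha
  simp only [adom, Set.mem_iUnion]
  exact ⟨A.ground α, hα A hA, a, e, he⟩

end Rules

/-! ## Generative Datalog programs -/

section Programs

variable {S : Type u}

/-- A parameterized distribution: the parameter space is a full Cartesian product of `dim > 0`
spaces `Dom (psort j)`, and for every parameter `p` the function `density p` is a density with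
respect to the measure `μ` on the underlying space `W`. Countable spaces with the counting measure
and `ℝⁿ` with Lebesgue measure are instances; for the latter, almost everywhere measurability with
respect to the Borel sets is measurability with respect to the Lebesgue measurable sets. -/
structure ParamDist (Dom : S → Type v) where
  dim : ℕ
  dim_pos : 0 < dim
  psort : Fin dim → S
  W : Type w
  [measurableSpace : MeasurableSpace W]
  [standardBorel : StandardBorelSpace W]
  μ : Measure W
  [sigmaFinite : SigmaFinite μ]
  density : (∀ j, Dom (psort j)) → W → ℝ≥0
  aemeasurable_density : ∀ p, AEMeasurable (density p) μ
  lintegral_density : ∀ p, ∫⁻ w, (density p w : ℝ≥0∞) ∂μ = 1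

attribute [instance] ParamDist.measurableSpace ParamDist.standardBorel ParamDist.sigmaFinite

/-- The density depends continuously on the parameter, for some separable metrizable topology on
the parameter space that generates its `σ`-algebra. -/
def ParamDist.IsContinuous {Dom : S → Type v} [∀ s, MeasurableSpace (Dom s)]
    (ψ : ParamDist.{u, v, w} Dom) : Prop :=
  ∃ _ : TopologicalSpace (∀ j, Dom (ψ.psort j)),
    BorelSpace (∀ j, Dom (ψ.psort j)) ∧
    TopologicalSpace.MetrizableSpace (∀ j, Dom (ψ.psort j)) ∧
    SecondCountableTopology (∀ j, Dom (ψ.psort j)) ∧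
    ∀ x : ψ.W, Continuous fun p => ψ.density p x

/-- Deterministic rules `R(t₁, …, tₙ) ← β`, with `R` intensional. -/
structure DetRule (σ : Schema S) (intensional : Set σ.Rel) (Dom : S → Type v) where
  body : Body σ Dom
  head : Atom σ Dom body.vs
  head_mem : head.rel ∈ intensional

/-- Probabilistic rules `R(…, ψ⟨p⟩, …) ← β`, with `R` intensional, where the probabilistic term
stands at the attribute `pos` and the other arguments are deterministic terms. The map `incl` is
the inclusion of the underlying space of `ψ` in the domain of the attribute `pos`. -/
structure ProbRule (σ : Schema S) (intensional : Set σ.Rel) (Dom : S → Type v)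
    [∀ s, MeasurableSpace (Dom s)] where
  body : Body σ Dom
  rel : σ.Rel
  rel_mem : rel ∈ intensional
  pos : σ.Attr rel
  args : ∀ a : {a // a ≠ pos}, Term Dom body.vs (σ.sort rel a)
  dist : ParamDist.{u, v, w} Dom
  params : ∀ j, Term Dom body.vs (dist.psort j)
  incl : dist.W → Dom (σ.sort rel pos)
  incl_injective : Function.Injective incl
  measurable_incl : Measurable incl

/-- GDatalog programs: finite bags of rules. The deterministic and the probabilistic rules of the
bag are listed separately. Relation symbols outside `intensional` are extensional. -/
structure Program (σ : Schema S) (intensional : Set σ.Rel) (Dom : S → Type v)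
    [∀ s, MeasurableSpace (Dom s)] where
  nDet : ℕ
  nProb : ℕ
  det : Fin nDet → DetRule σ intensional Dom
  prob : Fin nProb → ProbRule.{u, v, w} σ intensional Dom

end Programs

/-! ## Existential Datalog rules with sampling, and the parallel chase -/

section Chase

variable {S : Type u}

/-- A Datalog rule whose head has the relation symbol `rel`, existentially quantified variables at
the attributes in `Z` and the deterministic terms `args` at the other ones. It is annotated with
its sample space `(W, μ)`, the density of the sample outcome for each grounding of the
deterministic part of the head, and the inclusion of the sample outcomes in the domains of `Z`. -/
structure ERule (σ : Schema S) (Dom : S → Type v) where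
  body : Body σ Dom
  rel : σ.Rel
  Z : Set (σ.Attr rel)
  args : ∀ a : ↥Zᶜ, Term Dom body.vs (σ.sort rel a)
  W : Type w
  [measurableSpace : MeasurableSpace W]
  μ : Measure W
  [sigmaFinite : SigmaFinite μ]
  density : (∀ a : ↥Zᶜ, Dom (σ.sort rel a)) → W → ℝ≥0
  incl : W → ∀ a : ↥Z, Dom (σ.sort rel a)

attribute [instance] ERule.measurableSpace ERule.sigmaFinite

variable {σ : Schema S} {Dom : S → Type v}

namespace ERule

variable (φ : ERule.{u, v, w} σ Dom)

/-- The ground space of a rule: head groundings, without the existential attributes. -/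
abbrev Ground : Type v := ∀ a : ↥φ.Zᶜ, Dom (σ.sort φ.rel a)

/-- The head grounding induced by a valuation. -/
def ground (α : φ.body.Val) : φ.Ground := fun a => (φ.args a).eval α

open Classical in
/-- The head fact with values `g` at the deterministic and `z` at the existential attributes. -/
def headFact (g : φ.Ground) (z : ∀ a : ↥φ.Z, Dom (σ.sort φ.rel a)) : Fact σ Dom :=
  ⟨φ.rel, fun a => if h : a ∈ φ.Z then z ⟨a, h⟩ else g ⟨a, h⟩⟩

/-- The fact produced by a head grounding `g` and a sample outcome `b`. -/
def newFact (g : φ.Ground) (b : φ.W) : Fact σ Dom := φ.headFact g (φ.incl b)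

/-- `φ` is applicable in `D` for the valuation `α`: the body holds, the head does not. -/
def Applicable (D : DB σ Dom) (α : φ.body.Val) : Prop :=
  φ.body.Holds D α ∧ ¬ ∃ z, φ.headFact (φ.ground α) z ∈ D

end ERule

variable {ι : Type} [Finite ι] (P : ι → ERule.{u, v, w} σ Dom)

/-- The set of applicable pairs of an instance, for a finite bag `P` of rules. -/
def App (D : DB σ Dom) : Set (Σ i, (P i).Ground) :=
  {p | ∃ α, (P p.1).Applicable D α ∧ (P p.1).ground α = p.2}

theorem finite_App (D : DB σ Dom) : (App P D).Finite := by
  refine (Set.finite_iUnion fun i =>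
    (((P i).body.finite_holds D).image fun α => (⟨i, (P i).ground α⟩ : Σ i, (P i).Ground))).subset ?_
  rintro ⟨i, g⟩ ⟨α, hα, hg⟩
  exact Set.mem_iUnion.2 ⟨i, α, hα.1, Sigma.ext rfl (heq_of_eq hg)⟩

instance (D : DB σ Dom) : Fintype (App P D) := (finite_App P D).fintype

open Classical in
/-- The parallel extension function: all applicable pairs fire, the pair `p` with sample outcome
`b p`. -/
def parExt (D : DB σ Dom) (b : ∀ p : App P D, (P p.1.1).W) : DB σ Dom :=
  ⟨D.facts ∪ Finset.univ.image fun p : App P D => (P p.1.1).newFact p.1.2 (b p)⟩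

/-- The transition relation of the parallel chase. -/
def ParRel (D D' : DB σ Dom) : Prop :=
  ((App P D).Nonempty ∧ ∃ b, D' = parExt P D b) ∨ (¬ (App P D).Nonempty ∧ D' = D)

/-- The paths of the parallel chase. -/
def paths : Set (ℕ → DB σ Dom) := {ω | ∀ n, ParRel P (ω n) (ω (n + 1))}

/-- The paths of the parallel chase that start in `D`. -/
def pathsFrom (D : DB σ Dom) : Set (ℕ → DB σ Dom) := {ω | ω ∈ paths P ∧ ω 0 = D}

variable [∀ s, MeasurableSpace (Dom s)]

/-- The distribution of a parallel chase step: the samples of all applicable pairs are drawn from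
the product density with respect to the product measure, and are mapped to the instance that
arises from them. -/
def stepMeasure (D : DB σ Dom) : Measure (DB σ Dom) :=
  ((Measure.pi fun p : App P D => (P p.1.1).μ).withDensity
    fun b => ∏ p : App P D, ((P p.1.1).density p.1.2 (b p) : ℝ≥0∞)).map (parExt P D)

open Classical in
/-- The transition probabilities of the parallel chase. Instances without applicable pairs are
absorbing. -/
def parStep (D : DB σ Dom) : Measure (DB σ Dom) :=
  if (App P D).Nonempty then stepMeasure P D else Measure.dirac D

end Chase

/-- The path `ω` is terminating after `n` steps. -/
def TerminatesAt {X : Type*} (ω : ℕ → X) (n : ℕ) : Prop := ∀ m > n, ω n = ω m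

open Classical in
/-- The limit of the paths in `A` that terminate; all other paths are sent to the error event,
the element of `Unit`. -/
def limInst {X : Type*} (A : Set (ℕ → X)) (ω : ℕ → X) : X ⊕ Unit :=
  if h : ω ∈ A ∧ ∃ n, TerminatesAt ω n then Sum.inl (ω h.2.choose) else Sum.inr ()

/-- `Q` is the law on the path space of a Markov process with initial distribution `P₀` and
transition probabilities `κ`. -/
structure IsMarkovLaw {X : Type*} [MeasurableSpace X] (κ : X → Measure X) (P₀ : Measure X)
    (Q : Measure (ℕ → X)) : Prop where
  initial : Q.map (fun ω => ω 0) = P₀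
  transition : ∀ (n : ℕ) (A : Set (Fin (n + 1) → X)) (B : Set X),
    MeasurableSet A → MeasurableSet B →
    Q {ω | (fun i : Fin (n + 1) => ω i) ∈ A ∧ ω (n + 1) ∈ B} =
      ∫⁻ ω in {ω | (fun i : Fin (n + 1) => ω i) ∈ A}, κ (ω n) B ∂Q

/-- Sub-probability measures. -/
def IsSubProbability {X : Type*} [MeasurableSpace X] (Δ : Measure X) : Prop := Δ Set.univ ≤ 1

/-! ## The existential version of a program -/

namespace Program

variable {S : Type u} {σ : Schema S} {intensional : Set σ.Rel} {Dom : S → Type v}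
  [∀ s, MeasurableSpace (Dom s)] (G : Program.{u, v, w} σ intensional Dom)

/-- The schema of the existential version: for the `i`-th probabilistic rule
`R(u, ψ⟨p⟩) ← β` there is a new relation symbol `Rᵢ` with attributes for `u`, `p` and the sampled
value. -/
abbrev exSchema : Schema S where
  Rel := σ.Rel ⊕ Fin G.nProb
  Attr
    | .inl R => σ.Attr R
    | .inr i => {a // a ≠ (G.prob i).pos} ⊕ (Fin (G.prob i).dist.dim ⊕ Unit)
  sort
    | .inl R, a => σ.sort R a
    | .inr i, .inl a => σ.sort (G.prob i).rel a
    | .inr i, .inr (.inl j) => (G.prob i).dist.psort j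
    | .inr i, .inr (.inr _) => σ.sort (G.prob i).rel (G.prob i).pos
  finiteAttr
    | .inl R => inferInstanceAs (Finite (σ.Attr R))
    | .inr i => inferInstanceAs
        (Finite ({a // a ≠ (G.prob i).pos} ⊕ (Fin (G.prob i).dist.dim ⊕ Unit)))

/-- An atom over the original schema as an atom over the extended one. -/
def liftAtom {Var : Type} {vs : Var → S} (A : Atom σ Dom vs) : Atom G.exSchema Dom vs where
  rel := .inl A.rel
  args := A.args

/-- A body over the original schema as a body over the extended one. -/
def liftBody (β : Body σ Dom) : Body G.exSchema Dom where
  Var := β.Var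
  vs := β.vs
  atoms := β.atoms.map G.liftAtom
  occurs x := by
    obtain ⟨A, hA, a, ha⟩ := β.occurs x
    exact ⟨G.liftAtom A, List.mem_map_of_mem hA, a, ha⟩

/-- A deterministic rule with the given body and head; its sample space is a dummy one-point
probability space. -/
def mkDet (β : Body G.exSchema Dom) (A : Atom G.exSchema Dom β.vs) :
    ERule.{u, v, w} G.exSchema Dom where
  body := β
  rel := A.rel
  Z := ∅
  args a := A.args a
  W := PUnit
  μ := Measure.dirac PUnit.unit
  density _ _ := 1
  incl _ a := a.2.elim

/-- The rule `∃ z, Rᵢ(u, p, z) ← β` for the `i`-th probabilistic rule `R(u, ψ⟨p⟩) ← β`. -/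
def exRule (i : Fin G.nProb) : ERule.{u, v, w} G.exSchema Dom where
  body := G.liftBody (G.prob i).body
  rel := .inr i
  Z := {a | a = .inr (.inr ())}
  args
    | ⟨.inl a, _⟩ => (G.prob i).args a
    | ⟨.inr (.inl j), _⟩ => (G.prob i).params j
    | ⟨.inr (.inr ()), h⟩ => (h rfl).elim
  W := (G.prob i).dist.W
  μ := (G.prob i).dist.μ
  density g := (G.prob i).dist.density fun j => g ⟨.inr (.inl j), fun h => by cases h⟩
  incl b
    | ⟨.inl _, h⟩ => by cases h
    | ⟨.inr (.inl _), h⟩ => by cases h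
    | ⟨.inr (.inr ()), _⟩ => (G.prob i).incl b

/-- The variable `x` occurs in the head `R(u, ψ⟨p⟩)` of the `i`-th probabilistic rule. -/
def HeadVar (i : Fin G.nProb) (x : (G.prob i).body.Var) : Prop :=
  (∃ a, ((G.prob i).args a).IsVar x) ∨ ∃ j, ((G.prob i).params j).IsVar x

/-- The sorts of the variables of the rule `R(u, z) ← Rᵢ(u, p, z)`, where `none` stands for `z`. -/
def copySort (i : Fin G.nProb) : Option {x // G.HeadVar i x} → S :=
  fun o => o.elim (σ.sort (G.prob i).rel (G.prob i).pos) fun x => (G.prob i).body.vs x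

/-- The arguments `u` in the rule `R(u, z) ← Rᵢ(u, p, z)`. -/
def copyArg (i : Fin G.nProb) (a : {a // a ≠ (G.prob i).pos}) :
    Term Dom (G.copySort i) (σ.sort (G.prob i).rel a) :=
  ((G.prob i).args a).restrict (G.HeadVar i) _ fun _ h => Or.inl ⟨a, h⟩

/-- The arguments `p` in the rule `R(u, z) ← Rᵢ(u, p, z)`. -/
def copyParam (i : Fin G.nProb) (j : Fin (G.prob i).dist.dim) :
    Term Dom (G.copySort i) ((G.prob i).dist.psort j) :=
  ((G.prob i).params j).restrict (G.HeadVar i) _ fun _ h => Or.inr ⟨j, h⟩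

/-- The atom `Rᵢ(u, p, z)`. -/
def sampleAtom (i : Fin G.nProb) : Atom G.exSchema Dom (G.copySort i) where
  rel := .inr i
  args
    | .inl a => G.copyArg i a
    | .inr (.inl j) => G.copyParam i j
    | .inr (.inr ()) => .var none

/-- The body of the rule `R(u, z) ← Rᵢ(u, p, z)`. -/
def copyBody (i : Fin G.nProb) : Body G.exSchema Dom where
  Var := Option {x // G.HeadVar i x}
  vs := G.copySort i
  atoms := [G.sampleAtom i]
  occurs
    | none => ⟨_, List.mem_singleton_self _, .inr (.inr ()), rfl⟩
    | some ⟨x, h⟩ => by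
        refine ⟨_, List.mem_singleton_self _, ?_⟩
        rcases id h with ⟨a, ha⟩ | ⟨j, hj⟩
        · exact ⟨.inl a, Term.restrict_isVar _ _ ⟨x, h⟩ ha⟩
        · exact ⟨.inr (.inl j), Term.restrict_isVar _ _ ⟨x, h⟩ hj⟩

open Classical in
/-- The atom `R(u, z)`. -/
def copyHead (i : Fin G.nProb) : Atom G.exSchema Dom (G.copySort i) where
  rel := .inl (G.prob i).rel
  args a := if h : a = (G.prob i).pos then h ▸ .var none else G.copyArg i ⟨a, h⟩

/-- The existential version of the program, a finite bag of rules. -/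
def exRules : Fin G.nDet ⊕ (Fin G.nProb ⊕ Fin G.nProb) → ERule.{u, v, w} G.exSchema Dom
  | .inl i => G.mkDet (G.liftBody (G.det i).body) (G.liftAtom (G.det i).head)
  | .inr (.inl i) => G.exRule i
  | .inr (.inr i) => G.mkDet (G.copyBody i) (G.copyHead i)

/-- The space of instances over the schema of the existential version. -/
abbrev Inst : Type v := DB G.exSchema Dom

/-- Input instances: the instances over the extensional schema. -/
def inputs : Set G.Inst := {D | ∀ f ∈ D, ∃ R ∉ intensional, f.1 = .inl R}

/-- `Δ` is the output sub-probabilistic database of the parallel chase with initial distribution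
`P₀`, where `lim` assigns limit instances to paths: the image under `lim` of the law of the
associated Markov process, without the error event. -/
def IsParOutput (lim : (ℕ → G.Inst) → G.Inst ⊕ Unit) (P₀ Δ : Measure G.Inst) : Prop :=
  ∃ Q, IsMarkovLaw (parStep G.exRules) P₀ Q ∧ Δ = (Q.map lim).comap Sum.inl

end Program

end GDatalog

end

/-!
The proof rests on the description of instances as finite sets that depend measurably on a
parameter (`MeasurableFinset`). A standard Borel space embeds measurably into the real line, so a
measurable finite set of known size can be enumerated measurably, by sorting
(`MeasurableFinset.exists_enum`). Hence membership, unions, images, filters and products of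
measurable finite sets are measurable. Every variable of a rule occurs in its body, so the
valuations for which the body holds are among finitely many candidates that are read off from the
instance; this shows that the set of applicable pairs is a measurable finite set
(`measurableFinset_app`).

For the kernel, a chase step from `D` adds to `D` independent random facts, one for each applicable
pair, and the law of the fact depends measurably on the pair (`measurable_factLaw`). This uses
that the densities are jointly measurable off a null set, which follows from their continuity in the
parameter (`ParamDist.IsContinuous.exists_measurable_density`). Enumerating the applicable pairs
turns the step measure into an image of a product measure with a fixed index set, and measurability
in `D` follows (`measurable_parStep`).

For the limits, the transition relation is measurable (`measurable_parRel`): the facts that a pair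
may produce form an injective measurable image of a standard Borel space, hence a measurable set by
the Lusin-Souslin theorem, and only finitely many families of facts of the second instance can
witness a transition. So the set of paths is measurable. As equality of instances is measurable, so are the
events of termination, and with them the limit maps (`measurable_limInst`).

The law of the Markov process exists by the Ionescu-Tulcea theorem, and it is unique because its
finite-dimensional marginals are determined inductively (`existsUnique_isMarkovLaw`). The image of
a sub-probability measure under a measurable limit map, without the error event, is again a
sub-probability measure.
-/

namespace GDatalog

/-! ### Measurable finite sets -/

section MeasurableFinset

variable {Ω Ω' X Y : Type*} [MeasurableSpace Ω] [MeasurableSpace Ω'] [MeasurableSpace X]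
  [MeasurableSpace Y]

/-- A finite set depending measurably on `ω`, with respect to the `σ`-algebra of the counting
events: the number of its elements in any given measurable set is a measurable function. A predicate
on set-valued functions is used because Mathlib's `σ`-algebra on `Finset X` is generated by the
events `x ∈ D` for single points `x`, which is too coarse for uncountable `X`. -/
structure MeasurableFinset (F : Ω → Finset X) : Prop where
  measurable_ncard : ∀ B : Set X, MeasurableSet B → Measurable fun ω => ((F ω : Set X) ∩ B).ncard

/-- Measurability can be checked separately on the pieces of a countable measurable partition. -/
theorem measurable_of_restrict_fibers {N : Type*} [Countable N] [MeasurableSpace N]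
    [MeasurableSingletonClass N] {c : Ω → N} (hc : Measurable c) {f : Ω → Y}
    (h : ∀ n, Measurable fun ω : {ω // c ω = n} => f ω) : Measurable f := by
  intro s hs
  have : f ⁻¹' s = ⋃ n, Subtype.val '' ((fun ω : {ω // c ω = n} => f ω) ⁻¹' s) := by
    ext ω
    simp
  rw [this]
  exact .iUnion fun n => .subtype_image (hc (measurableSet_singleton n)) (h n hs)

namespace MeasurableFinset

variable {F G : Ω → Finset X}

theorem card (hF : MeasurableFinset F) : Measurable fun ω => (F ω).card := by
  simpa using hF.measurable_ncard Set.univ .univ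

theorem comp (hF : MeasurableFinset F) {f : Ω' → Ω} (hf : Measurable f) :
    MeasurableFinset fun ω => F (f ω) :=
  ⟨fun B hB => (hF.measurable_ncard B hB).comp hf⟩

theorem of_restrict_fibers {N : Type*} [Countable N] [MeasurableSpace N]
    [MeasurableSingletonClass N] {c : Ω → N} (hc : Measurable c)
    (h : ∀ n, MeasurableFinset fun ω : {ω // c ω = n} => F ω) : MeasurableFinset F :=
  ⟨fun B hB => measurable_of_restrict_fibers hc fun n => (h n).measurable_ncard B hB⟩

theorem empty : MeasurableFinset fun _ : Ω => (∅ : Finset X) := ⟨fun B _ => by simp⟩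

theorem ite {p : Ω → Prop} [DecidablePred p] (hp : Measurable p) (hF : MeasurableFinset F)
    (hG : MeasurableFinset G) : MeasurableFinset fun ω => if p ω then F ω else G ω := by
  refine ⟨fun B hB => ?_⟩
  have : Measurable fun ω => if p ω then ((F ω : Set X) ∩ B).ncard else ((G ω : Set X) ∩ B).ncard :=
    .ite (measurableSet_setOfPred.2 hp) (hF.measurable_ncard B hB) (hG.measurable_ncard B hB)
  convert this using 2 with ω
  by_cases h : p ω <;> simp [h]

/-- A finite subset of a standard Borel space that depends measurably on `ω` can be enumerated
measurably: transported to the real line it can be sorted, and the `k`-th smallest element is at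
most `t` if and only if more than `k` elements are. -/
theorem exists_enum [StandardBorelSpace X] [DecidableEq X] (hF : MeasurableFinset F) (n : ℕ) :
    ∃ e : {ω // (F ω).card = n} → Fin n → X, Measurable e ∧
      ∀ ω, Function.Injective (e ω) ∧ Finset.univ.image (e ω) = F ω := by
  have hr := measurableEmbedding_embeddingReal X
  set r := embeddingReal X
  have hcard (ω : {ω // (F ω).card = n}) : ((F ω).image r).card = n := by
    rw [Finset.card_image_of_injective _ hr.injective, ω.2]
  let s (ω : {ω // (F ω).card = n}) : Fin n ↪o ℝ := ((F ω).image r).orderEmbOfFin (hcard ω)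
  have hs (ω : {ω // (F ω).card = n}) (k : Fin n) : ∃ x ∈ F ω, r x = s ω k :=
    Finset.mem_image.1 (Finset.orderEmbOfFin_mem _ (hcard ω) k)
  choose e heF he using hs
  have hinj (ω) : Function.Injective (e ω) := fun k l hkl =>
    (s ω).injective (by rw [← he, ← he, hkl])
  refine ⟨e, measurable_pi_lambda _ fun k => ?_, fun ω => ⟨hinj ω, ?_⟩⟩
  · rw [← hr.measurable_comp_iff]
    refine measurable_of_Iic fun t => ?_
    have key (ω : {ω // (F ω).card = n}) :
        r (e ω k) ≤ t ↔ (k : ℕ) < ((F ω : Set X) ∩ r ⁻¹' Set.Iic t).ncard := by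
      have hset : ((F ω : Set X) ∩ r ⁻¹' Set.Iic t).ncard
          = (Finset.univ.filter fun l => s ω l ≤ t).card := by
        rw [← Set.ncard_image_of_injective _ hr.injective, ← Set.ncard_coe_finset,
          ← Set.ncard_image_of_injective _ (s ω).injective]
        congr 1
        ext y
        have hy : y ∈ Set.range (s ω) ↔ y ∈ r '' (F ω : Set X) := by
          rw [Finset.range_orderEmbOfFin, Finset.coe_image]
        simp only [Set.mem_image, Set.mem_range, Set.mem_inter_iff, Set.mem_preimage, Set.mem_Iic,
          Finset.coe_filter, Finset.mem_univ, true_and, Set.mem_ofPred_eq] at hy ⊢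
        constructor
        · rintro ⟨x, ⟨hx, hxt⟩, rfl⟩
          obtain ⟨l, hl⟩ := hy.2 ⟨x, hx, rfl⟩
          exact ⟨l, hl ▸ hxt, hl⟩
        · rintro ⟨l, hl, rfl⟩
          obtain ⟨x, hx, hxl⟩ := hy.1 ⟨l, rfl⟩
          exact ⟨x, ⟨hx, hxl ▸ hl⟩, hxl⟩
      rw [hset, he]
      constructor
      · intro h
        have : Finset.Iic k ⊆ Finset.univ.filter fun l => s ω l ≤ t := fun l hl => by
          simpa using ((s ω).monotone (Finset.mem_Iic.1 hl)).trans h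
        have := Finset.card_le_card this
        rw [Fin.card_Iic] at this
        omega
      · intro h
        by_contra! hk
        have : (Finset.univ.filter fun l => s ω l ≤ t) ⊆ Finset.Iio k := fun l hl => by
          simp only [Finset.mem_filter, Finset.mem_univ, true_and] at hl
          exact Finset.mem_Iio.2 ((s ω).lt_iff_lt.1 (hl.trans_lt hk))
        have := Finset.card_le_card this
        rw [Fin.card_Iio] at this
        omega
    have : (r ∘ fun ω => e ω k) ⁻¹' Set.Iic t
        = {ω | (k : ℕ) < ((F ω.1 : Set X) ∩ r ⁻¹' Set.Iic t).ncard} := by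
      ext ω
      exact key ω
    rw [this]
    exact measurableSet_lt measurable_const
      ((hF.measurable_ncard _ (hr.measurable measurableSet_Iic)).comp measurable_subtype_coe)
  · refine Finset.eq_of_subset_of_card_le (fun x hx => ?_) ?_
    · obtain ⟨k, -, rfl⟩ := Finset.mem_image.1 hx
      exact heF ω k
    · rw [Finset.card_image_of_injective _ (hinj ω), Finset.card_univ, Fintype.card_fin, ω.2]

theorem measurable_mem [StandardBorelSpace X] (hF : MeasurableFinset F) {f : Ω → X}
    (hf : Measurable f) : Measurable fun ω => f ω ∈ F ω := by
  classical
  refine measurable_of_restrict_fibers hF.card fun n => ?_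
  obtain ⟨e, he, heF⟩ := hF.exists_enum n
  have (ω : {ω // (F ω).card = n}) : f ω ∈ F ω ↔ ∃ k, e ω k = f ω := by
    simp [← (heF ω).2]
  simp only [this]
  fun_prop

theorem insert [StandardBorelSpace X] [DecidableEq X] (hF : MeasurableFinset F) {f : Ω → X}
    (hf : Measurable f) : MeasurableFinset fun ω => insert (f ω) (F ω) := by
  classical
  refine ⟨fun B hB => ?_⟩
  have hp : Measurable fun ω => f ω ∈ B ∧ f ω ∉ F ω :=
    ((_root_.measurable_mem.2 hB).comp hf).and (hF.measurable_mem hf).not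
  have : Measurable fun ω => if f ω ∈ B ∧ f ω ∉ F ω then ((F ω : Set X) ∩ B).ncard + 1
      else ((F ω : Set X) ∩ B).ncard :=
    .ite (measurableSet_setOfPred.2 hp) ((hF.measurable_ncard B hB).add_const 1)
      (hF.measurable_ncard B hB)
  -- the new element is counted if and only if it lies in `B` and was not present before
  convert this using 2 with ω
  rw [Finset.coe_insert]
  split_ifs with h
  · rw [Set.insert_inter_of_mem h.1, Set.ncard_insert_of_notMem (fun h' => h.2 h'.1)
      ((F ω).finite_toSet.subset Set.inter_subset_left)]
  · by_cases hB : f ω ∈ B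
    · have hF : f ω ∈ F ω := by simpa [hB] using h
      rw [Set.insert_eq_of_mem (by exact_mod_cast hF)]
    · rw [Set.insert_inter_of_notMem hB]

theorem singleton [StandardBorelSpace X] {f : Ω → X} (hf : Measurable f) :
    MeasurableFinset fun ω => ({f ω} : Finset X) := by
  classical exact empty.insert hf

theorem union_image [StandardBorelSpace X] [DecidableEq X] {K : Type*}
    (hF : MeasurableFinset F) (s : Finset K) {e : K → Ω → X} (he : ∀ k, Measurable (e k)) :
    MeasurableFinset fun ω => F ω ∪ s.image (e · ω) := by
  classical
  induction s using Finset.induction_on with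
  | empty => simpa using hF
  | insert k s _ ih => simpa using ih.insert (he k)

theorem union [StandardBorelSpace X] [DecidableEq X] (hF : MeasurableFinset F)
    (hG : MeasurableFinset G) :
    MeasurableFinset fun ω => F ω ∪ G ω := by
  refine of_restrict_fibers hG.card fun n => ?_
  obtain ⟨e, he, heG⟩ := hG.exists_enum n
  have := (hF.comp measurable_subtype_coe).union_image Finset.univ
    (e := fun k (ω : {ω // (G ω).card = n}) => e ω k) fun k => by fun_prop
  convert this using 3 with ω
  exact (heG ω).2.symm

theorem finset_biUnion [StandardBorelSpace X] [DecidableEq X] {K : Type*} (s : Finset K)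
    {G : K → Ω → Finset X} (hG : ∀ k, MeasurableFinset (G k)) :
    MeasurableFinset fun ω => s.biUnion (G · ω) := by
  classical
  induction s using Finset.induction_on with
  | empty => simpa using empty
  | insert k s _ ih => simpa [Finset.biUnion_insert] using (hG k).union ih

theorem biUnion [StandardBorelSpace X] [StandardBorelSpace Y] [DecidableEq Y]
    (hF : MeasurableFinset F) {H : Ω → X → Finset Y}
    (hH : MeasurableFinset fun p : Ω × X => H p.1 p.2) :
    MeasurableFinset fun ω => (F ω).biUnion (H ω) := by
  classical
  refine of_restrict_fibers hF.card fun n => ?_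
  obtain ⟨e, he, heF⟩ := hF.exists_enum n
  have := finset_biUnion Finset.univ
    (G := fun k (ω : {ω // (F ω).card = n}) => H ω (e ω k)) fun k =>
      hH.comp (f := fun ω : {ω // (F ω).card = n} => (ω.1, e ω k)) (by fun_prop)
  convert this using 2 with ω
  rw [← (heF ω).2, Finset.image_biUnion]

theorem image [StandardBorelSpace X] [StandardBorelSpace Y] [DecidableEq Y]
    (hF : MeasurableFinset F) {f : X → Y} (hf : Measurable f) :
    MeasurableFinset fun ω => (F ω).image f := by
  simp only [← Finset.biUnion_singleton]
  exact hF.biUnion (singleton (by fun_prop))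

theorem filter [StandardBorelSpace X] (hF : MeasurableFinset F) {p : Ω → X → Prop}
    [∀ ω, DecidablePred (p ω)] (hp : Measurable fun q : Ω × X => p q.1 q.2) :
    MeasurableFinset fun ω => (F ω).filter (p ω) := by
  classical
  have : (fun ω => (F ω).filter (p ω))
      = fun ω => (F ω).biUnion fun x => if p ω x then {x} else ∅ := by
    ext ω x
    simp only [Finset.mem_filter, Finset.mem_biUnion]
    constructor
    · rintro ⟨h, h'⟩
      exact ⟨x, h, by simp [h']⟩
    · rintro ⟨y, h, h'⟩
      split_ifs at h' with hy
      · rw [Finset.mem_singleton] at h'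
        exact h' ▸ ⟨h, hy⟩
      · simp at h'
  rw [this]
  have h : MeasurableFinset fun q : Ω × X => if p q.1 q.2 then ({q.2} : Finset X) else ∅ :=
    .ite hp (singleton measurable_snd) empty
  exact hF.biUnion h

theorem piFinset {K : Type*} [Fintype K] [DecidableEq K] {X : K → Type*}
    [∀ k, MeasurableSpace (X k)] [∀ k, StandardBorelSpace (X k)] {F : ∀ k, Ω → Finset (X k)}
    (hF : ∀ k, MeasurableFinset (F k)) :
    MeasurableFinset fun ω => Fintype.piFinset fun k => F k ω := by
  classical
  refine of_restrict_fibers (c := fun ω k => (F k ω).card)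
    (measurable_pi_lambda _ fun k => (hF k).card) fun n => ?_
  choose e he heF using fun k => (hF k).exists_enum (n k)
  have hn (ω : {ω // (fun k => (F k ω).card) = n}) (k : K) : (F k ω).card = n k :=
    congrFun ω.2 k
  have he' (j : ∀ k, Fin (n k)) : Measurable
      fun (ω : {ω // (fun k => (F k ω).card) = n}) k => e k ⟨ω, hn ω k⟩ (j k) := by
    refine measurable_pi_lambda _ fun k => ?_
    have : Measurable fun ω : {ω // (fun k => (F k ω).card) = n} =>
        (⟨ω, hn ω k⟩ : {ω // (F k ω).card = n k}) := measurable_subtype_coe.subtype_mk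
    have h := (he k).comp this
    exact h.eval
  have := empty.union_image Finset.univ he'
  convert this using 2 with ω
  ext x
  simp only [Fintype.mem_piFinset, Finset.empty_union, Finset.mem_image, Finset.mem_univ, true_and]
  have hx (k : K) : x k ∈ F k ω ↔ ∃ j, e k ⟨ω, hn ω k⟩ j = x k := by
    rw [← (heF k ⟨ω, hn ω k⟩).2]
    simp
  simp only [hx]
  constructor
  · intro h
    choose j hj using h
    exact ⟨j, funext hj⟩
  · rintro ⟨j, rfl⟩ k
    exact ⟨j k, rfl⟩

theorem measurable_subset [StandardBorelSpace X] (hF : MeasurableFinset F)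
    (hG : MeasurableFinset G) : Measurable fun ω => F ω ⊆ G ω := by
  classical
  have hm : MeasurableFinset fun ω => (F ω).filter (· ∉ G ω) :=
    hF.filter (p := fun ω x => x ∉ G ω)
      ((hG.comp measurable_fst).measurable_mem measurable_snd).not
  have (ω : Ω) : F ω ⊆ G ω ↔ ((F ω).filter (· ∉ G ω)).card = 0 := by
    simp [Finset.card_eq_zero, Finset.filter_eq_empty_iff, Finset.subset_iff]
  simp only [this]
  exact hm.card.eq measurable_const

theorem measurable_eq [StandardBorelSpace X] (hF : MeasurableFinset F)
    (hG : MeasurableFinset G) : Measurable fun ω => F ω = G ω := by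
  simp only [Finset.Subset.antisymm_iff]
  exact (hF.measurable_subset hG).and (hG.measurable_subset hF)

end MeasurableFinset

end MeasurableFinset

/-! ### Disjoint unions of measurable spaces -/

section Sigma

variable {ι : Type*} {X : ι → Type*} [∀ i, MeasurableSpace (X i)] {Y : Type*} [MeasurableSpace Y]

theorem measurableSet_sigma_iff {s : Set (Σ i, X i)} :
    MeasurableSet s ↔ ∀ i, MeasurableSet (Sigma.mk i ⁻¹' s) := by
  change MeasurableSet[⨅ i, _] s ↔ _
  rw [MeasurableSpace.measurableSet_iInf]
  rfl

theorem measurable_sigma_mk (i : ι) : Measurable (Sigma.mk i : X i → Σ i, X i) :=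
  fun _ hs => measurableSet_sigma_iff.1 hs i

theorem measurable_of_sigma {f : (Σ i, X i) → Y} (h : ∀ i, Measurable fun x => f ⟨i, x⟩) :
    Measurable f :=
  fun _ hs => measurableSet_sigma_iff.2 fun i => h i hs

theorem measurableEmbedding_sigma_mk (i : ι) :
    MeasurableEmbedding (Sigma.mk i : X i → Σ i, X i) where
  injective := sigma_mk_injective
  measurable := measurable_sigma_mk i
  measurableSet_image' := fun s hs => by
    refine measurableSet_sigma_iff.2 fun j => ?_
    by_cases h : i = j
    · subst h
      rwa [Set.preimage_image_eq _ sigma_mk_injective]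
    · rw [Set.preimage_image_sigmaMk_of_ne (Ne.symm h)]
      exact .empty

instance [Countable ι] [∀ i, StandardBorelSpace (X i)] : StandardBorelSpace (Σ i, X i) := by
  let _ := fun i => upgradeStandardBorel (X i)
  refine ⟨⟨inferInstance, ⟨?_⟩, {}⟩⟩
  refine le_antisymm (fun s hs => ?_) (MeasurableSpace.generateFrom_le fun s hs => ?_)
  · have : s = ⋃ i, Sigma.mk i '' (Sigma.mk i ⁻¹' s) := by
      ext y
      simp only [Set.mem_iUnion, Set.mem_image, Set.mem_preimage]
      exact ⟨fun h => ⟨y.1, y.2, h, rfl⟩, by rintro ⟨i, x, h, rfl⟩; exact h⟩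
    rw [this]
    let _ : MeasurableSpace (Σ i, X i) := borel _
    have : BorelSpace (Σ i, X i) := ⟨rfl⟩
    exact .iUnion fun i => Topology.IsOpenEmbedding.sigmaMk.measurableEmbedding.measurableSet_image'
      (measurableSet_sigma_iff.1 hs i)
  · exact measurableSet_sigma_iff.2 fun i => (isOpen_sigma_iff.1 hs i).measurableSet

theorem MeasurableFinset.preimage {Ω X : Type*} [MeasurableSpace Ω] [MeasurableSpace X]
    {F : Ω → Finset Y} (hF : MeasurableFinset F) {f : X → Y} (hf : MeasurableEmbedding f) :
    MeasurableFinset fun ω => (F ω).preimage f hf.injective.injOn := by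
  refine ⟨fun B hB => ?_⟩
  convert hF.measurable_ncard _ (hf.measurableSet_image' hB) using 2 with ω
  rw [Finset.coe_preimage, ← Set.ncard_image_of_injective _ hf.injective, Set.image_preimage_inter]

end Sigma

/-! ### The measurable space of instances -/

section Databases

variable {S : Type u} {σ : Schema S} {Dom : S → Type v}

/-- The finite set of the tuples in a given relation of an instance. -/
noncomputable def DB.tuples (D : DB σ Dom) (R : σ.Rel) :
    Finset (∀ a : σ.Attr R, Dom (σ.sort R a)) :=
  D.facts.preimage (fun t => (⟨R, t⟩ : Fact σ Dom)) fun _ _ _ _ h => eq_of_heq (Sigma.mk.inj h).2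

theorem DB.mem_tuples {D : DB σ Dom} {R : σ.Rel} {t : ∀ a : σ.Attr R, Dom (σ.sort R a)} :
    t ∈ D.tuples R ↔ (⟨R, t⟩ : Fact σ Dom) ∈ D :=
  Finset.mem_preimage

variable [∀ s, MeasurableSpace (Dom s)] {Ω : Type*} [MeasurableSpace Ω]

theorem measurableFinset_facts : MeasurableFinset fun D : DB σ Dom => D.facts := by
  refine ⟨fun B hB => ?_⟩
  refine measurable_to_countable' fun n => ?_
  exact MeasurableSpace.measurableSet_generateFrom ⟨B, n, hB, rfl⟩

theorem measurable_db_iff {F : Ω → DB σ Dom} :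
    Measurable F ↔ MeasurableFinset fun ω => (F ω).facts := by
  refine ⟨fun h => measurableFinset_facts.comp h, fun h => measurable_generateFrom ?_⟩
  rintro _ ⟨B, n, hB, rfl⟩
  exact h.measurable_ncard B hB (measurableSet_singleton n)

theorem measurableFinset_tuples (R : σ.Rel) :
    MeasurableFinset fun D : DB σ Dom => D.tuples R :=
  measurableFinset_facts.preimage (measurableEmbedding_sigma_mk R)

variable [∀ s, StandardBorelSpace (Dom s)]

instance : MeasurableEq (DB σ Dom) where
  measurableSet_diagonal := by
    have := MeasurableFinset.measurable_eq
      (measurableFinset_facts.comp (measurable_fst (α := DB σ Dom) (β := DB σ Dom)))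
      (measurableFinset_facts.comp measurable_snd)
    convert measurableSet_setOfPred.2 this using 1
    ext ⟨D, D'⟩
    exact DB.ext_iff

theorem measurable_mem_db {F : Ω → DB σ Dom} (hF : Measurable F)
    {f : Ω → Fact σ Dom} (hf : Measurable f) : Measurable fun ω => f ω ∈ F ω :=
  (measurable_db_iff.1 hF).measurable_mem hf

end Databases

/-! ### The applicable pairs depend measurably on the instance -/

section Rules

open scoped Classical

variable {S : Type u} {σ : Schema S} {Dom : S → Type v}

theorem Term.exists_eval_eq_of_isVar {Var : Type} {vs : Var → S} {s : S} {x : Var}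
    (t : Term Dom vs s) (h : t.IsVar x) :
    ∃ e : s = vs x, ∀ α : ∀ x, Dom (vs x), e ▸ t.eval α = α x := by
  cases t with
  | var y => cases h; exact ⟨rfl, fun _ => rfl⟩
  | const c => exact h.elim

theorem ERule.exists_headFact_mem_iff (φ : ERule.{u, v, w} σ Dom) {D : DB σ Dom} {g : φ.Ground} :
    (∃ z, φ.headFact g z ∈ D) ↔
      g ∈ (D.tuples φ.rel).image fun t (a : ↥φ.Zᶜ) => t a := by
  simp only [Finset.mem_image]
  constructor
  · rintro ⟨z, hz⟩
    exact ⟨_, DB.mem_tuples.2 hz, funext fun a => dif_neg (c := a.1 ∈ φ.Z) a.2⟩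
  · rintro ⟨t, ht, rfl⟩
    refine ⟨fun a => t a, ?_⟩
    have : φ.headFact (fun a => t a) (fun a => t a) = ⟨φ.rel, t⟩ :=
      Sigma.ext rfl (heq_of_eq (funext fun a => by
        simp only [headFact]; split_ifs <;> rfl))
    rw [this]
    exact DB.mem_tuples.1 ht

variable [∀ s, MeasurableSpace (Dom s)]

theorem Term.measurable_eval {Var : Type} {vs : Var → S} {s : S} (t : Term Dom vs s) :
    Measurable fun α : ∀ x, Dom (vs x) => t.eval α := by
  cases t with
  | var x => exact measurable_pi_apply x
  | const c => exact measurable_const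

theorem Atom.measurable_ground {Var : Type} {vs : Var → S} (A : Atom σ Dom vs) :
    Measurable A.ground :=
  (measurable_sigma_mk A.rel).comp (measurable_pi_lambda _ fun a => (A.args a).measurable_eval)

theorem ERule.measurable_ground (φ : ERule.{u, v, w} σ Dom) : Measurable φ.ground :=
  measurable_pi_lambda _ fun a => (φ.args a).measurable_eval

theorem measurable_eqRec {s t : S} (e : s = t) : Measurable fun x : Dom s => e ▸ x := by
  subst e
  exact measurable_id

variable [∀ s, StandardBorelSpace (Dom s)]

theorem Body.measurable_holds (β : Body σ Dom) :
    Measurable fun q : DB σ Dom × β.Val => β.Holds q.1 q.2 := by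
  have (q : DB σ Dom × β.Val) :
      β.Holds q.1 q.2 ↔ ∀ k : Fin β.atoms.length, (β.atoms.get k).ground q.2 ∈ q.1 :=
    List.forall_mem_iff_get
  simp only [this]
  exact .forall fun k => measurable_mem_db measurable_fst
    ((Atom.measurable_ground _).comp measurable_snd)

/-- A body holds only for valuations into a finite set that depends measurably on the instance:
the value of each variable is read off from the tuples of an atom in which the variable occurs. -/
theorem Body.exists_measurableFinset_val (β : Body σ Dom) :
    ∃ V : DB σ Dom → Finset β.Val, MeasurableFinset V ∧ ∀ D α, β.Holds D α → α ∈ V D := by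
  have := Fintype.ofFinite β.Var
  have h (x : β.Var) : ∃ V : DB σ Dom → Finset (Dom (β.vs x)), MeasurableFinset V ∧
      ∀ D α, β.Holds D α → α x ∈ V D := by
    obtain ⟨A, hA, a, ha⟩ := β.occurs x
    obtain ⟨e, he⟩ := Term.exists_eval_eq_of_isVar _ ha
    refine ⟨fun D => (D.tuples A.rel).image fun t => e ▸ t a, (measurableFinset_tuples _).image
      ((measurable_eqRec e).comp (measurable_pi_apply a)), fun D α hα => ?_⟩
    exact Finset.mem_image.2 ⟨_, DB.mem_tuples.2 (hα A hA), he α⟩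
  choose V hV hVα using h
  exact ⟨fun D => Fintype.piFinset fun x => V x D, .piFinset hV, fun D α hα =>
    Fintype.mem_piFinset.2 fun x => hVα x D α hα⟩

theorem ERule.measurable_applicable (φ : ERule.{u, v, w} σ Dom) :
    Measurable fun q : DB σ Dom × φ.body.Val => φ.Applicable q.1 q.2 := by
  refine φ.body.measurable_holds.and (Measurable.not ?_)
  simp only [exists_headFact_mem_iff]
  refine MeasurableFinset.measurable_mem (F := fun q : DB σ Dom × φ.body.Val => _) ?_
    (φ.measurable_ground.comp measurable_snd)
  exact ((measurableFinset_tuples φ.rel).image (by fun_prop)).comp measurable_fst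

theorem measurableFinset_app {ι : Type} [Finite ι] (P : ι → ERule.{u, v, w} σ Dom) :
    MeasurableFinset fun D => (finite_App P D).toFinset := by
  have := Fintype.ofFinite ι
  choose V hV hVα using fun i => (P i).body.exists_measurableFinset_val
  have key (i : ι) : MeasurableFinset fun D =>
      ((V i D).filter ((P i).Applicable D)).image fun α =>
        (⟨i, (P i).ground α⟩ : Σ i, (P i).Ground) :=
    ((hV i).filter (p := (P i).Applicable) (P i).measurable_applicable).image
      ((measurable_sigma_mk i).comp (P i).measurable_ground)
  convert MeasurableFinset.finset_biUnion Finset.univ key using 2 with D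
  ext ⟨i, g⟩
  simp only [Set.Finite.mem_toFinset, App, Set.mem_ofPred_eq, Finset.mem_biUnion, Finset.mem_univ,
    true_and, Finset.mem_image, Finset.mem_filter]
  constructor
  · rintro ⟨α, hα, rfl⟩
    exact ⟨i, α, ⟨hVα i D α hα.1, hα⟩, rfl⟩
  · rintro ⟨j, α, ⟨-, hα⟩, h⟩
    cases h
    exact ⟨α, hα, rfl⟩

end Rules

/-! ### Products of measures with densities -/

section PiDensity

theorem lintegral_fin_prod {n : ℕ} {X : Fin n → Type*} [∀ i, MeasurableSpace (X i)]
    (μ : ∀ i, Measure (X i)) [∀ i, SigmaFinite (μ i)] {f : ∀ i, X i → ℝ≥0∞}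
    (hf : ∀ i, AEMeasurable (f i) (μ i)) :
    ∫⁻ x, ∏ i, f i (x i) ∂Measure.pi μ = ∏ i, ∫⁻ x, f i x ∂μ i := by
  induction n with
  | zero => simp
  | succ n ih =>
    have h := (measurePreserving_piFinSuccAbove μ 0).symm
    rw [← h.lintegral_comp_emb (MeasurableEquiv.measurableEmbedding _), Fin.prod_univ_succ,
      ← ih _ fun i => hf i.succ, ← lintegral_prod_mul (hf 0)]
    · simp_rw [MeasurableEquiv.piFinSuccAbove_symm_apply, Fin.insertNthEquiv,
        Fin.prod_univ_succ, Fin.insertNth_zero]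
      rfl
    · exact Finset.aemeasurable_fun_prod _ fun i _ =>
        (hf i.succ).comp_quasiMeasurePreserving (Measure.quasiMeasurePreserving_eval _ i)

theorem lintegral_fintype_prod {ι : Type*} [Fintype ι] {X : ι → Type*}
    [∀ i, MeasurableSpace (X i)] (μ : ∀ i, Measure (X i)) [∀ i, SigmaFinite (μ i)]
    {f : ∀ i, X i → ℝ≥0∞} (hf : ∀ i, AEMeasurable (f i) (μ i)) :
    ∫⁻ x, ∏ i, f i (x i) ∂Measure.pi μ = ∏ i, ∫⁻ x, f i x ∂μ i := by
  let e := (Fintype.equivFin ι).symm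
  rw [← (measurePreserving_piCongrLeft μ e).lintegral_comp_emb
    (MeasurableEquiv.measurableEmbedding _), ← e.prod_comp,
    ← lintegral_fin_prod _ fun i => hf (e i)]
  refine lintegral_congr fun x => ?_
  rw [← e.prod_comp]
  exact Finset.prod_congr rfl fun i _ => by rw [MeasurableEquiv.piCongrLeft_apply_apply]

theorem pi_withDensity {ι : Type*} [Fintype ι] {X : ι → Type*} [∀ i, MeasurableSpace (X i)]
    (μ : ∀ i, Measure (X i)) [∀ i, SigmaFinite (μ i)] {f : ∀ i, X i → ℝ≥0∞}
    (hf : ∀ i, AEMeasurable (f i) (μ i)) [∀ i, SigmaFinite ((μ i).withDensity (f i))] :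
    (Measure.pi μ).withDensity (fun x => ∏ i, f i (x i)) =
      Measure.pi fun i => (μ i).withDensity (f i) := by
  refine (Measure.pi_eq fun s hs => ?_).symm
  rw [withDensity_apply _ (.univ_pi hs), Measure.restrict_pi_pi, lintegral_fintype_prod]
  · exact Finset.prod_congr rfl fun i _ => (withDensity_apply _ (hs i)).symm
  · exact fun i => (hf i).restrict

/-- Finite products of probability measures depend measurably on a parameter if the factors do. -/
theorem measurable_measure_pi {Ω ι : Type*} [Fintype ι] {X : ι → Type*} [MeasurableSpace Ω]
    [∀ i, MeasurableSpace (X i)] {μ : Ω → ∀ i, Measure (X i)}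
    [∀ ω i, IsProbabilityMeasure (μ ω i)] (hμ : ∀ i, Measurable fun ω => μ ω i) :
    Measurable fun ω => Measure.pi (μ ω) := by
  refine Measurable.measure_of_isPiSystem_of_isProbabilityMeasure generateFrom_pi.symm
    isPiSystem_pi ?_
  rintro _ ⟨s, hs, rfl⟩
  simp only [Measure.pi_pi]
  exact Finset.measurable_fun_prod _ fun i _ =>
    (Measure.measurable_coe (hs i (Set.mem_univ i))).comp (hμ i)

end PiDensity

/-! ### The law of the fact produced by a rule -/

section FactLaw

variable {S : Type u} {σ : Schema S} {Dom : S → Type v}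

theorem ERule.headFact_injective {φ : ERule.{u, v, w} σ Dom} {g : φ.Ground} :
    Function.Injective (φ.headFact g) := by
  intro z z' h
  have h' := eq_of_heq (Sigma.mk.inj h).2
  funext a
  simpa [a.2] using congrFun h' a.1

variable [∀ s, MeasurableSpace (Dom s)]

namespace ERule

/-- The conditions on an existential rule with sampling that the measurability of the chase rests
on: sample outcomes form a standard Borel space, which is measurably included in the domains of the
existential attributes, and the density is a probability density that, off a single null set of
outcomes, is jointly measurable in the head grounding and the outcome. -/
structure Regular (φ : ERule.{u, v, w} σ Dom) : Prop where
  standardBorel : StandardBorelSpace φ.W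
  measurable_incl : Measurable φ.incl
  injective_incl : Function.Injective φ.incl
  exists_measurable_density : ∃ f : φ.Ground × φ.W → ℝ≥0∞, Measurable f ∧
    ∀ᵐ b ∂φ.μ, ∀ g, (φ.density g b : ℝ≥0∞) = f (g, b)
  lintegral_density : ∀ g, ∫⁻ b, φ.density g b ∂φ.μ = 1

variable {φ : ERule.{u, v, w} σ Dom}

theorem Regular.measurable_newFact (h : φ.Regular) :
    Measurable fun q : φ.Ground × φ.W => φ.newFact q.1 q.2 := by
  refine (measurable_sigma_mk φ.rel).comp (measurable_pi_lambda _ fun a => ?_)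
  by_cases ha : a ∈ φ.Z
  · simp only [ha, dif_pos]
    exact (measurable_pi_apply _).comp (h.measurable_incl.comp measurable_snd)
  · simp only [ha, dif_neg, not_false_eq_true]
    exact (measurable_pi_apply _).comp measurable_fst

theorem Regular.aemeasurable_density (h : φ.Regular) (g : φ.Ground) :
    AEMeasurable (fun b => (φ.density g b : ℝ≥0∞)) φ.μ := by
  obtain ⟨f, hf, hfd⟩ := h.exists_measurable_density
  exact ⟨fun b => f (g, b), hf.comp measurable_prodMk_left, hfd.mono fun b hb => hb g⟩

theorem Regular.isProbabilityMeasure_withDensity (h : φ.Regular) (g : φ.Ground) :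
    IsProbabilityMeasure (φ.μ.withDensity fun b => φ.density g b) :=
  ⟨by rw [withDensity_apply _ .univ, setLIntegral_univ, h.lintegral_density]⟩

end ERule

variable {ι : Type} (P : ι → ERule.{u, v, w} σ Dom)

/-- The distribution of the fact that is produced when the pair `p` of a rule and a head grounding
fires. -/
noncomputable def factLaw (p : Σ i, (P i).Ground) : Measure (Fact σ Dom) :=
  ((P p.1).μ.withDensity fun b => ((P p.1).density p.2 b : ℝ≥0∞)).map ((P p.1).newFact p.2)

variable {P}

theorem isProbabilityMeasure_factLaw (hP : ∀ i, (P i).Regular) (p : Σ i, (P i).Ground) :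
    IsProbabilityMeasure (factLaw P p) :=
  have := (hP p.1).isProbabilityMeasure_withDensity p.2
  Measure.isProbabilityMeasure_map
    ((hP p.1).measurable_newFact.comp measurable_prodMk_left).aemeasurable

theorem measurable_factLaw (hP : ∀ i, (P i).Regular) : Measurable (factLaw P) := by
  refine measurable_of_sigma fun i => Measure.measurable_of_measurable_coe _ fun s hs => ?_
  obtain ⟨f, hf, hfd⟩ := (hP i).exists_measurable_density
  have hn := (hP i).measurable_newFact
  have (g : (P i).Ground) : factLaw P ⟨i, g⟩ s =
      ∫⁻ b, ((fun q : (P i).Ground × (P i).W => (P i).newFact q.1 q.2) ⁻¹' s).indicator f (g, b)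
        ∂(P i).μ := by
    have hg : Measurable ((P i).newFact g) := hn.comp measurable_prodMk_left
    rw [factLaw, Measure.map_apply hg hs, withDensity_apply _ (hg hs),
      ← lintegral_indicator (hg hs)]
    refine lintegral_congr_ae (hfd.mono fun b hb => ?_)
    simp only [Set.indicator, Set.mem_preimage, hb]
    rfl
  simp only [this]
  exact (hf.indicator (hn hs)).lintegral_prod_right'

end FactLaw

/-! ### The transition probabilities of the parallel chase -/

section Step

open scoped Classical

variable {S : Type u} {σ : Schema S} {Dom : S → Type v}

/-- The instance that arises from `D` by adding a finite family of facts. -/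
noncomputable def DB.extend (D : DB σ Dom) {K : Type*} [Fintype K] (x : K → Fact σ Dom) :
    DB σ Dom :=
  ⟨D.facts ∪ Finset.univ.image x⟩

theorem DB.extend_comp_equiv (D : DB σ Dom) {K L : Type*} [Fintype K] [Fintype L] (e : K ≃ L)
    (x : L → Fact σ Dom) : D.extend (x ∘ e) = D.extend x := by
  ext f
  simp [DB.extend, e.surjective.exists]

variable {ι : Type} [Finite ι] {P : ι → ERule.{u, v, w} σ Dom}

theorem parExt_eq_extend (D : DB σ Dom) (b : ∀ p : App P D, (P p.1.1).W) :
    parExt P D b = D.extend fun p : App P D => (P p.1.1).newFact p.1.2 (b p) :=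
  rfl

/-- An enumeration of the applicable pairs as an equivalence. -/
theorem exists_equiv_app {D : DB σ Dom} {m : ℕ} {e : Fin m → Σ i, (P i).Ground}
    (he : Function.Injective e) (heD : Finset.univ.image e = (finite_App P D).toFinset) :
    ∃ e' : Fin m ≃ App P D, ∀ k, (e' k).1 = e k := by
  have hmem (p) : p ∈ App P D ↔ ∃ k, e k = p := by
    rw [← (finite_App P D).mem_toFinset, ← heD]
    simp
  exact ⟨Equiv.ofBijective (fun k => ⟨e k, (hmem _).2 ⟨k, rfl⟩⟩)
    ⟨fun k l h => he (congrArg Subtype.val h), fun p => by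
      obtain ⟨k, hk⟩ := (hmem p).1 p.2
      exact ⟨k, Subtype.ext hk⟩⟩, fun k => rfl⟩

variable [∀ s, MeasurableSpace (Dom s)] [∀ s, StandardBorelSpace (Dom s)]

theorem measurable_extend {K : Type*} [Fintype K] :
    Measurable fun q : DB σ Dom × (K → Fact σ Dom) => q.1.extend q.2 :=
  measurable_db_iff.2 ((measurableFinset_facts.comp measurable_fst).union_image Finset.univ
    (e := fun k (q : DB σ Dom × (K → Fact σ Dom)) => q.2 k) fun k =>
      (measurable_pi_apply k).comp measurable_snd)

theorem DB.measurable_extend (D : DB σ Dom) {K : Type*} [Fintype K] :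
    Measurable (D.extend : (K → Fact σ Dom) → DB σ Dom) :=
  GDatalog.measurable_extend.comp measurable_prodMk_left

/-- A parallel chase step adds independent random facts to the instance. -/
theorem stepMeasure_eq_map_pi_factLaw (hP : ∀ i, (P i).Regular) (D : DB σ Dom) :
    stepMeasure P D = (Measure.pi fun p : App P D => factLaw P p.1).map D.extend := by
  have (p : App P D) := (hP p.1.1).isProbabilityMeasure_withDensity p.1.2
  have hf (p : App P D) := isProbabilityMeasure_factLaw hP p.1
  have hn (p : App P D) : Measurable ((P p.1.1).newFact p.1.2) :=
    (hP p.1.1).measurable_newFact.comp measurable_prodMk_left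
  have : ∀ p : App P D, SigmaFinite
    (((P p.1.1).μ.withDensity fun b => ((P p.1.1).density p.1.2 b : ℝ≥0∞)).map
      ((P p.1.1).newFact p.1.2)) := fun p =>
    have : IsProbabilityMeasure _ := hf p
    inferInstance
  unfold stepMeasure factLaw
  rw [pi_withDensity (f := fun p : App P D => fun b => ((P p.1.1).density p.1.2 b : ℝ≥0∞)) _
      fun p => (hP p.1.1).aemeasurable_density p.1.2,
    ← Measure.pi_map_pi fun p => (hn p).aemeasurable,
    Measure.map_map D.measurable_extend
      (measurable_pi_lambda (fun (x : ∀ p : App P D, (P p.1.1).W) p =>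
        (P p.1.1).newFact p.1.2 (x p)) fun p => (hn p).comp (measurable_pi_apply p))]
  rfl

/-- The step measure in terms of an enumeration of the applicable pairs. The index set no longer
depends on the instance, which makes measurability in the instance accessible. -/
theorem stepMeasure_eq_map_pi_enum (hP : ∀ i, (P i).Regular) {D : DB σ Dom} {m : ℕ}
    {e : Fin m → Σ i, (P i).Ground} (he : Function.Injective e)
    (heD : Finset.univ.image e = (finite_App P D).toFinset) :
    stepMeasure P D = (Measure.pi fun k => factLaw P (e k)).map D.extend := by
  have hf := isProbabilityMeasure_factLaw hP
  obtain ⟨e', he'⟩ := exists_equiv_app he heD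
  simp only [← he']
  rw [stepMeasure_eq_map_pi_factLaw hP, ← Measure.pi_map_piCongrLeft e',
    Measure.map_map D.measurable_extend (MeasurableEquiv.measurable _)]
  congr 1
  funext x
  rw [Function.comp_apply, ← DB.extend_comp_equiv D e']
  congr 1
  funext k
  exact MeasurableEquiv.piCongrLeft_apply_apply (β := fun _ => Fact σ Dom) e' x k

/-- Without applicable pairs the sample space of a chase step is a single point, so that the step
measure is the Dirac measure as well. -/
theorem parStep_eq_stepMeasure (hP : ∀ i, (P i).Regular) (D : DB σ Dom) :
    parStep P D = stepMeasure P D := by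
  unfold parStep
  split_ifs with h
  · rfl
  · have : IsEmpty (App P D) := Set.isEmpty_coe_sort.2 (Set.not_nonempty_iff_eq_empty.1 h)
    rw [stepMeasure_eq_map_pi_factLaw hP, Measure.pi_of_empty _ isEmptyElim,
      Measure.map_dirac' D.measurable_extend]
    congr 1
    ext f
    simp [DB.extend]

theorem isProbabilityMeasure_parStep (hP : ∀ i, (P i).Regular) (D : DB σ Dom) :
    IsProbabilityMeasure (parStep P D) := by
  have hf := isProbabilityMeasure_factLaw hP
  rw [parStep_eq_stepMeasure hP, stepMeasure_eq_map_pi_factLaw hP]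
  exact Measure.isProbabilityMeasure_map
    D.measurable_extend.aemeasurable

theorem measurable_parStep (hP : ∀ i, (P i).Regular) : Measurable (parStep P) := by
  have hf := isProbabilityMeasure_factLaw hP
  rw [funext (parStep_eq_stepMeasure hP)]
  have hA := measurableFinset_app P
  refine measurable_of_restrict_fibers hA.card fun m => ?_
  obtain ⟨e, he, heA⟩ := hA.exists_enum m
  have heq (D : {D : DB σ Dom // (finite_App P D).toFinset.card = m}) :
      stepMeasure P D.1 = (Measure.pi fun k => factLaw P (e D k)).map D.1.extend :=
    stepMeasure_eq_map_pi_enum hP (heA D).1 (heA D).2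
  simp only [heq]
  refine Measure.measurable_of_measurable_coe _ fun s hs => ?_
  let κ : ProbabilityTheory.Kernel {D : DB σ Dom // (finite_App P D).toFinset.card = m}
      (Fin m → Fact σ Dom) :=
    ⟨fun D => Measure.pi fun k => factLaw P (e D k), measurable_measure_pi fun k =>
      (measurable_factLaw hP).comp he.eval⟩
  have : ProbabilityTheory.IsMarkovKernel κ := ⟨fun D => by dsimp [κ]; infer_instance⟩
  have hκ := ProbabilityTheory.Kernel.measurable_kernel_prodMk_left (κ := κ)
    (measurable_extend.comp
      ((measurable_subtype_coe.comp measurable_fst).prodMk measurable_snd) hs)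
  convert hκ using 2 with D
  exact Measure.map_apply D.1.measurable_extend hs

end Step

/-! ### Paths of the parallel chase -/

section Paths

open scoped Classical

variable {S : Type u} {σ : Schema S} {Dom : S → Type v} {ι : Type} [Finite ι]
  {P : ι → ERule.{u, v, w} σ Dom}

/-- Without applicable pairs the extension function returns the instance itself, so that the two
cases in the definition of the transition relation merge. -/
theorem parRel_iff_exists_parExt {D D' : DB σ Dom} :
    ParRel P D D' ↔ ∃ b, D' = parExt P D b := by
  unfold ParRel
  by_cases h : (App P D).Nonempty
  · simp [h]
  · have : IsEmpty (App P D) := Set.isEmpty_coe_sort.2 (Set.not_nonempty_iff_eq_empty.1 h)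
    have hD (b) : parExt P D b = D := by
      ext f
      simp [parExt]
    simp [h, hD]

variable [∀ s, MeasurableSpace (Dom s)] [∀ s, StandardBorelSpace (Dom s)]

/-- The facts that a pair of a rule and a head grounding may produce form a measurable relation:
the sample outcome is determined by the fact, so that the graph is an injective measurable image. -/
theorem measurableSet_newFact (hP : ∀ i, (P i).Regular) :
    MeasurableSet {q : (Σ i, (P i).Ground) × Fact σ Dom |
      ∃ b, q.2 = (P q.1.1).newFact q.1.2 b} := by
  have (i : ι) : MeasurableSet (Set.range fun q : (P i).Ground × (P i).W =>
      ((⟨i, q.1⟩ : Σ i, (P i).Ground), (P i).newFact q.1 q.2)) := by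
    have := (hP i).standardBorel
    rw [← Set.image_univ]
    refine MeasurableSet.univ.image_of_measurable_injOn (((measurable_sigma_mk i).comp
      measurable_fst).prodMk (hP i).measurable_newFact) (Function.Injective.injOn ?_)
    rintro ⟨g, b⟩ ⟨g', b'⟩ h
    obtain ⟨h1, h2⟩ := Prod.mk.inj h
    obtain rfl := sigma_mk_injective h1
    exact Prod.ext rfl ((hP i).injective_incl (ERule.headFact_injective h2))
  convert MeasurableSet.iUnion this using 1
  ext ⟨⟨i, g⟩, f⟩
  simp only [Set.mem_ofPred_eq, Set.mem_iUnion, Set.mem_range]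
  constructor
  · rintro ⟨b, rfl⟩
    exact ⟨i, (g, b), rfl⟩
  · rintro ⟨j, ⟨g', b⟩, h⟩
    obtain ⟨h1, h2⟩ := Prod.mk.inj h
    cases h1
    exact ⟨b, h2.symm⟩

/-- The transition relation is measurable: whether `D'` arises from `D` is decided by finitely many
families of facts of `D'`, one fact for each applicable pair. -/
theorem measurable_parRel (hP : ∀ i, (P i).Regular) :
    Measurable fun q : DB σ Dom × DB σ Dom => ParRel P q.1 q.2 := by
  have hN := measurableSet_newFact hP
  set N := {q : (Σ i, (P i).Ground) × Fact σ Dom | ∃ b, q.2 = (P q.1.1).newFact q.1.2 b}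
  have hA := (measurableFinset_app P).comp (measurable_fst (β := DB σ Dom))
  refine measurable_of_restrict_fibers hA.card fun m => ?_
  let Ω := {q : DB σ Dom × DB σ Dom // (finite_App P q.1).toFinset.card = m}
  obtain ⟨(e : Ω → Fin m → Σ i, (P i).Ground), he, heA⟩ := hA.exists_enum m
  have h₁ : Measurable fun q : Ω => q.1.1 := measurable_fst.comp measurable_subtype_coe
  have h₂ : Measurable fun q : Ω => q.1.2 := measurable_snd.comp measurable_subtype_coe
  -- the families of facts of the second instance, one for each applicable pair of the first, that
  -- witness the transition
  have hT : MeasurableFinset fun q : Ω =>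
      (Fintype.piFinset fun k => q.1.2.facts.filter fun f => (e q k, f) ∈ N).filter
        fun x => q.1.2 = q.1.1.extend x := by
    refine MeasurableFinset.filter (p := fun q x => q.1.2 = q.1.1.extend x) (.piFinset fun k =>
      (measurable_db_iff.1 h₂).filter (p := fun q f => (e q k, f) ∈ N) ?_) ?_
    · exact (measurable_mem.2 hN).comp
        ((he.eval.comp measurable_fst).prodMk measurable_snd)
    · exact (h₂.comp measurable_fst).eq
        (measurable_extend.comp ((h₁.comp measurable_fst).prodMk measurable_snd))
  have key (q : Ω) : ParRel P q.1.1 q.1.2 ↔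
      ((Fintype.piFinset fun k => q.1.2.facts.filter fun f => (e q k, f) ∈ N).filter
        fun x => q.1.2 = q.1.1.extend x).card ≠ 0 := by
    obtain ⟨e', he'⟩ := exists_equiv_app (heA q).1 (heA q).2
    rw [parRel_iff_exists_parExt, Finset.card_ne_zero]
    constructor
    · rintro ⟨b, hb⟩
      refine ⟨(fun p : App P q.1.1 => (P p.1.1).newFact p.1.2 (b p)) ∘ e', ?_⟩
      rw [Finset.mem_filter, Fintype.mem_piFinset, DB.extend_comp_equiv]
      refine ⟨fun k => Finset.mem_filter.2 ⟨?_, ?_⟩, hb⟩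
      · rw [hb]
        exact Finset.mem_union_right _ (Finset.mem_image_of_mem _ (Finset.mem_univ _))
      · rw [← he']
        exact ⟨_, rfl⟩
    · rintro ⟨x, hx⟩
      rw [Finset.mem_filter, Fintype.mem_piFinset] at hx
      have hb (p : App P q.1.1) : ∃ b, x (e'.symm p) = (P p.1.1).newFact p.1.2 b := by
        have := (Finset.mem_filter.1 (hx.1 (e'.symm p))).2
        rwa [← he', e'.apply_symm_apply] at this
      choose b hb using hb
      refine ⟨b, ?_⟩
      rw [parExt_eq_extend, ← funext hb, hx.2]
      exact (DB.extend_comp_equiv _ e'.symm x).symm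
  simp only [key]
  exact (hT.card.eq measurable_const).not

theorem measurableSet_paths (hP : ∀ i, (P i).Regular) : MeasurableSet (paths P) := by
  refine measurableSet_setOfPred.2 (.forall fun n => ?_)
  exact (measurable_parRel hP).comp
    ((measurable_pi_apply n).prodMk (measurable_pi_apply (n + 1)) :
      Measurable fun ω : ℕ → DB σ Dom => (ω n, ω (n + 1)))

theorem measurableSet_pathsFrom (hP : ∀ i, (P i).Regular) (D : DB σ Dom) :
    MeasurableSet (pathsFrom P D) :=
  (measurableSet_paths hP).inter
    (measurableSet_setOfPred.2 ((measurable_pi_apply 0).eq measurable_const))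

end Paths

/-! ### Limits of terminating paths -/

section Limit

variable {X : Type*} {A : Set (ℕ → X)}

theorem limInst_eq_inl {ω : ℕ → X} (hA : ω ∈ A) {n : ℕ} (hn : TerminatesAt ω n) :
    limInst A ω = Sum.inl (ω n) := by
  have h : ω ∈ A ∧ ∃ n, TerminatesAt ω n := ⟨hA, n, hn⟩
  rw [limInst, dif_pos h]
  rcases lt_trichotomy h.2.choose n with h' | h' | h'
  · rw [h.2.choose_spec n h']
  · rw [h']
  · rw [hn _ h']

/-- On the paths of `A` that terminate after `n` steps, the limit is the `n`-th state. -/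
theorem measurable_limInst [MeasurableSpace X] [MeasurableEq X] (hA : MeasurableSet A) :
    Measurable (limInst A) := by
  have hT (n : ℕ) : MeasurableSet {ω : ℕ → X | ω ∈ A ∧ TerminatesAt ω n} := by
    refine hA.inter (measurableSet_setOfPred.2 (.forall fun m => .imp measurable_const ?_))
    exact (measurable_pi_apply n).eq (measurable_pi_apply m)
  intro s hs
  have : limInst A ⁻¹' s =
      (⋃ n, {ω | ω ∈ A ∧ TerminatesAt ω n} ∩ (fun ω => ω n) ⁻¹' (Sum.inl ⁻¹' s))
      ∪ ((⋃ n, {ω | ω ∈ A ∧ TerminatesAt ω n})ᶜ ∩ {_ω | Sum.inr () ∈ s}) := by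
    ext ω
    by_cases h : ω ∈ A ∧ ∃ n, TerminatesAt ω n
    · obtain ⟨hA, n, hn⟩ := h
      have hlim (m) (hm : TerminatesAt ω m) : limInst A ω = Sum.inl (ω m) := limInst_eq_inl hA hm
      simp only [Set.mem_preimage, Set.mem_union, Set.mem_iUnion, Set.mem_inter_iff,
        Set.mem_ofPred_eq, Set.mem_compl_iff]
      constructor
      · intro hs
        exact Or.inl ⟨n, ⟨hA, hn⟩, hlim n hn ▸ hs⟩
      · rintro (⟨m, hm, hs⟩ | ⟨h, -⟩)
        · exact hlim m hm.2 ▸ hs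
        · exact (h ⟨n, hA, hn⟩).elim
    · rw [Set.mem_preimage, limInst, dif_neg h]
      have h' (n) : ¬ (ω ∈ A ∧ TerminatesAt ω n) := fun hn => h ⟨hn.1, n, hn.2⟩
      simp [h']
  rw [this]
  exact (MeasurableSet.iUnion fun n => (hT n).inter
    (measurable_pi_apply n (measurable_inl hs))).union ((MeasurableSet.iUnion hT).compl.inter
      (.const _))

end Limit

/-! ### Existence and uniqueness of the law of a Markov process -/

section MarkovLaw

open ProbabilityTheory Preorder

variable {X : Type*} [MeasurableSpace X] {κ : X → Measure X} {P₀ : Measure X}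

/-- The projection of the path space to the first `n + 1` states. -/
def initialStates (n : ℕ) (ω : ℕ → X) : Fin (n + 1) → X := fun i => ω i

theorem measurable_initialStates (n : ℕ) : Measurable (initialStates n : (ℕ → X) → _) :=
  measurable_pi_lambda _ fun i => measurable_pi_apply (i : ℕ)

/-- The Ionescu-Tulcea theorem for a time-homogeneous kernel and an `s`-finite initial
distribution. -/
theorem exists_isMarkovLaw [SFinite P₀] (hκ : Measurable κ) [∀ x, IsProbabilityMeasure (κ x)] :
    ∃ Q, IsMarkovLaw κ P₀ Q := by
  let K (n : ℕ) : Kernel (∀ _ : Finset.Iic n, X) X :=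
    ⟨fun x => κ (x ⟨n, Finset.mem_Iic.2 le_rfl⟩), hκ.comp (measurable_pi_apply _)⟩
  have (n : ℕ) : IsMarkovKernel (K n) := ⟨fun x => by dsimp [K]; infer_instance⟩
  let c : X → ∀ _ : Finset.Iic 0, X := fun x _ => x
  have hc : Measurable c := measurable_pi_lambda _ fun _ => measurable_id
  let Q := Kernel.traj (X := fun _ => X) K 0 ∘ₘ P₀.map c
  have hQ (n : ℕ) : Q.map (frestrictLe n) ⊗ₘ K n =
      Q.map fun ω => (frestrictLe n ω, ω (n + 1)) := by
    rw [Measure.compProd_eq_comp_prod, Measure.map_comp _ _ (by fun_prop),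
      Kernel.traj_map_frestrictLe, Measure.comp_assoc, Measure.map_comp _ _ (by fun_prop)]
    congr with x₀ : 1
    rw [Kernel.comp_apply, ← Measure.compProd_eq_comp_prod, Kernel.map_apply _ (by fun_prop),
      Kernel.partialTraj_compProd_eq_map_traj zero_le]
  refine ⟨Q, ?_, fun n A B hA hB => ?_⟩
  · have h0 : Q.map (frestrictLe 0) = P₀.map c := by
      rw [Measure.map_comp _ _ (by fun_prop), Kernel.traj_map_frestrictLe, Kernel.partialTraj_self,
        Measure.id_comp]
    have : (fun ω : ℕ → X => ω 0) =
        (fun x : ∀ _ : Finset.Iic 0, X => x ⟨0, Finset.mem_Iic.2 le_rfl⟩) ∘ frestrictLe 0 := rfl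
    have h : Measurable fun x : ∀ _ : Finset.Iic 0, X => x ⟨0, Finset.mem_Iic.2 le_rfl⟩ :=
      measurable_pi_apply _
    rw [this, ← Measure.map_map h (measurable_frestrictLe 0), h0, Measure.map_map h hc]
    exact Measure.map_id
  · let r : (∀ _ : Finset.Iic n, X) → Fin (n + 1) → X := fun x i =>
      x ⟨i, Finset.mem_Iic.2 (Nat.lt_succ_iff.1 i.2)⟩
    have hr : Measurable r := measurable_pi_lambda _ fun i => measurable_pi_apply _
    have hm : Measurable fun ω : ℕ → X => (frestrictLe (π := fun _ => X) n ω, ω (n + 1)) :=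
      (measurable_frestrictLe n).prodMk (measurable_pi_apply _)
    calc Q {ω | initialStates n ω ∈ A ∧ ω (n + 1) ∈ B}
        = (Q.map fun ω => (frestrictLe n ω, ω (n + 1))) ((r ⁻¹' A) ×ˢ B) :=
          (Measure.map_apply hm ((hr hA).prod hB)).symm
      _ = ∫⁻ x in r ⁻¹' A, K n x B ∂Q.map (frestrictLe n) := by
          rw [← hQ, Measure.compProd_apply_prod (hr hA) hB]
      _ = ∫⁻ ω in {ω | initialStates n ω ∈ A}, κ (ω n) B ∂Q :=
          setLIntegral_map (hr hA) (Kernel.measurable_coe _ hB) (by fun_prop)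

theorem IsMarkovLaw.measure_univ {Q : Measure (ℕ → X)} (hQ : IsMarkovLaw κ P₀ Q) :
    Q Set.univ = P₀ Set.univ := by
  rw [← hQ.initial, Measure.map_apply (measurable_pi_apply 0) .univ, Set.preimage_univ]

/-- The transition law determines the joint law of the first `n + 2` states on measurable
rectangles, given that of the first `n + 1` states. -/
theorem IsMarkovLaw.map_initialStates_eq [IsFiniteMeasure P₀] (hκ : Measurable κ)
    {Q Q' : Measure (ℕ → X)} (hQ : IsMarkovLaw κ P₀ Q) (hQ' : IsMarkovLaw κ P₀ Q') (n : ℕ) :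
    Q.map (initialStates n) = Q'.map (initialStates n) := by
  have : IsFiniteMeasure Q := ⟨hQ.measure_univ ▸ measure_lt_top P₀ _⟩
  induction n with
  | zero =>
    have : (initialStates 0 : (ℕ → X) → _) = (fun x _ => x) ∘ fun ω => ω 0 := by
      funext ω i
      rw [show i = 0 from Fin.fin_one_eq_zero i]
      rfl
    have hc : Measurable fun (x : X) (_ : Fin (0 + 1)) => x :=
      measurable_pi_lambda _ fun _ => measurable_id
    rw [this, ← Measure.map_map hc (measurable_pi_apply 0),
      ← Measure.map_map hc (measurable_pi_apply 0), hQ.initial, hQ'.initial]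
  | succ n ih =>
    have hm : Measurable fun ω : ℕ → X => (initialStates n ω, ω (n + 1)) :=
      (measurable_initialStates n).prodMk (measurable_pi_apply _)
    have hpair : Q.map (fun ω => (initialStates n ω, ω (n + 1))) =
        Q'.map fun ω => (initialStates n ω, ω (n + 1)) := by
      refine Measure.ext_prod fun {A B} hA hB => ?_
      have hB' : Measurable fun x : Fin (n + 1) → X => κ (x (Fin.last n)) B :=
        (Measure.measurable_coe hB).comp (hκ.comp (measurable_pi_apply _))
      have key {Q : Measure (ℕ → X)} (hQ : IsMarkovLaw κ P₀ Q) :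
          Q.map (fun ω => (initialStates n ω, ω (n + 1))) (A ×ˢ B) =
            ∫⁻ x in A, κ (x (Fin.last n)) B ∂Q.map (initialStates n) := by
        rw [Measure.map_apply hm (hA.prod hB),
          setLIntegral_map hA hB' (measurable_initialStates n)]
        exact hQ.transition n A B hA hB
      rw [key hQ, key hQ', ih]
    have hsnoc : Measurable fun q : (Fin (n + 1) → X) × X =>
        (Fin.snoc q.1 q.2 : Fin (n + 2) → X) := by
      refine measurable_pi_lambda _ fun i => ?_
      refine Fin.lastCases ?_ (fun i => ?_) i
      · simpa using measurable_snd
      · simpa [Function.comp_def] using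
          (measurable_pi_apply i).comp (measurable_fst (α := Fin (n + 1) → X) (β := X))
    have hcomp : (initialStates (n + 1) : (ℕ → X) → _) =
        (fun q : (Fin (n + 1) → X) × X => (Fin.snoc q.1 q.2 : Fin (n + 2) → X)) ∘
          fun ω => (initialStates n ω, ω (n + 1)) := by
      funext ω i
      refine Fin.lastCases ?_ (fun i => ?_) i <;> simp [initialStates]
    rw [hcomp, ← Measure.map_map hsnoc hm, hpair, Measure.map_map hsnoc hm]

theorem IsMarkovLaw.unique [IsFiniteMeasure P₀] (hκ : Measurable κ)
    {Q Q' : Measure (ℕ → X)} (hQ : IsMarkovLaw κ P₀ Q) (hQ' : IsMarkovLaw κ P₀ Q') : Q = Q' := by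
  have : IsFiniteMeasure Q := ⟨hQ.measure_univ ▸ measure_lt_top P₀ _⟩
  refine IsProjectiveLimit.unique (P := fun I => Q.map I.restrict) (fun I => rfl) fun I => ?_
  let g : (Fin (I.sup id + 1) → X) → ∀ _ : I, X := fun y i =>
    y ⟨i, Nat.lt_succ_of_le (Finset.le_sup (f := id) i.2)⟩
  have hg : Measurable g := measurable_pi_lambda _ fun i => measurable_pi_apply _
  have : (I.restrict : (ℕ → X) → _) = g ∘ initialStates (I.sup id) := rfl
  change Q'.map I.restrict = Q.map I.restrict
  rw [this, ← Measure.map_map hg (measurable_initialStates _),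
    ← Measure.map_map hg (measurable_initialStates _), hQ.map_initialStates_eq hκ hQ']

theorem existsUnique_isMarkovLaw [IsFiniteMeasure P₀] (hκ : Measurable κ)
    [∀ x, IsProbabilityMeasure (κ x)] : ∃! Q, IsMarkovLaw κ P₀ Q :=
  existsUnique_of_exists_of_unique (exists_isMarkovLaw hκ) fun _ _ h h' => h.unique hκ h'

end MarkovLaw

/-! ### Regularity of the rules of the existential version -/

section Regular

variable {S : Type u} {Dom : S → Type v} [∀ s, MeasurableSpace (Dom s)]

/-- Densities that depend continuously on the parameter are jointly measurable off a null set: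
they are measurable on the complement of one null set for all parameters in a countable dense set,
hence for all parameters, and continuity in the parameter yields joint measurability. -/
theorem ParamDist.IsContinuous.exists_measurable_density {ψ : ParamDist.{u, v, w} Dom}
    (hψ : ψ.IsContinuous) :
    ∃ f : (∀ j, Dom (ψ.psort j)) × ψ.W → ℝ≥0∞, Measurable f ∧
      ∀ᵐ b ∂ψ.μ, ∀ p, (ψ.density p b : ℝ≥0∞) = f (p, b) := by
  obtain ⟨_, hB, hM, hS, hc⟩ := hψ
  obtain ⟨d, hdc, hd⟩ := TopologicalSpace.exists_countable_dense (∀ j, Dom (ψ.psort j))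
  have hae : ∀ᵐ b ∂ψ.μ, ∀ p ∈ d, ψ.density p b = (ψ.aemeasurable_density p).mk _ b :=
    (ae_ball_iff hdc).2 fun p _ => (ψ.aemeasurable_density p).ae_eq_mk
  set t := toMeasurable ψ.μ
    {b | ¬ ∀ p ∈ d, ψ.density p b = (ψ.aemeasurable_density p).mk _ b}
  have ht : MeasurableSet t := measurableSet_toMeasurable _ _
  have htd {b : ψ.W} (hb : b ∉ t) {p} (hp : p ∈ d) :
      ψ.density p b = (ψ.aemeasurable_density p).mk _ b := by
    by_contra h
    exact hb (subset_toMeasurable _ _ fun h' => h (h' p hp))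
  let f (p : ∀ j, Dom (ψ.psort j)) : ψ.W → ℝ≥0 := tᶜ.indicator (ψ.density p)
  have hfc (b : ψ.W) : Continuous fun p => f p b := by
    by_cases hb : b ∈ t
    · simpa [f, hb] using continuous_const
    · simpa [f, hb] using hc b
  have hfd {p} (hp : p ∈ d) : Measurable (f p) := by
    have : f p = tᶜ.indicator ((ψ.aemeasurable_density p).mk _) :=
      Set.indicator_congr fun b hb => htd hb hp
    rw [this]
    exact (ψ.aemeasurable_density p).measurable_mk.indicator ht.compl
  have hfm (p) : Measurable (f p) := by
    obtain ⟨x, hxd, hx⟩ := mem_closure_iff_seq_limit.1 (hd p)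
    exact measurable_of_tendsto_metrizable (fun n => hfd (hxd n))
      (tendsto_pi_nhds.2 fun b => ((hfc b).tendsto p).comp hx)
  refine ⟨fun q => f q.1 q.2,
    (measurable_uncurry_of_continuous_of_measurable hfc hfm).coe_nnreal_ennreal, ?_⟩
  have ht0 : ∀ᵐ b ∂ψ.μ, b ∉ t := by
    rw [ae_iff]
    simp only [not_not]
    exact (measure_toMeasurable _).trans (ae_iff.1 hae)
  filter_upwards [ht0] with b hb p
  simp [f, hb]

variable {σ : Schema S} {intensional : Set σ.Rel} (G : Program.{u, v, w} σ intensional Dom)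

namespace Program

theorem regular_mkDet (β : Body G.exSchema Dom) (A : Atom G.exSchema Dom β.vs) :
    (G.mkDet β A).Regular where
  standardBorel := inferInstanceAs (StandardBorelSpace PUnit)
  measurable_incl := measurable_pi_lambda _ fun a => a.2.elim
  injective_incl := fun _ _ _ => rfl
  exists_measurable_density := ⟨fun _ => 1, measurable_const, .of_forall fun _ _ => rfl⟩
  lintegral_density := fun _ => by
    change ∫⁻ _, ((1 : ℝ≥0) : ℝ≥0∞) ∂Measure.dirac PUnit.unit = 1
    simp

theorem regular_exRule {i : Fin G.nProb} (h : (G.prob i).dist.IsContinuous) :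
    (G.exRule i).Regular where
  standardBorel := (G.prob i).dist.standardBorel
  measurable_incl := measurable_pi_lambda _ fun
    | ⟨.inl _, h⟩ => by cases h
    | ⟨.inr (.inl _), h⟩ => by cases h
    | ⟨.inr (.inr ()), _⟩ => (G.prob i).measurable_incl
  injective_incl := fun _ _ h =>
    (G.prob i).incl_injective (congrFun h ⟨.inr (.inr ()), rfl⟩)
  exists_measurable_density := by
    obtain ⟨f, hf, hfd⟩ := h.exists_measurable_density
    refine ⟨fun q => f (fun j => q.1 ⟨.inr (.inl j), fun h => by cases h⟩, q.2), hf.comp ?_,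
      hfd.mono fun b hb g => hb _⟩
    exact (measurable_pi_lambda _ fun j => (measurable_pi_apply _).comp measurable_fst).prodMk
      measurable_snd
  lintegral_density := fun _ => (G.prob i).dist.lintegral_density _

theorem regular_exRules (h : ∀ i, (G.prob i).dist.IsContinuous) : ∀ i, (G.exRules i).Regular
  | .inl _ => G.regular_mkDet _ _
  | .inr (.inl i) => G.regular_exRule (h i)
  | .inr (.inr _) => G.regular_mkDet _ _

end Program

end Regular

/-! ### The output of the parallel chase -/

section Output

variable {X : Type*} [MeasurableSpace X] {κ : X → Measure X} {P₀ : Measure X}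

theorem isSubProbability_comap_map {Q : Measure (ℕ → X)} (hQ : Q Set.univ ≤ 1)
    {lim : (ℕ → X) → X ⊕ Unit} (hlim : Measurable lim) :
    IsSubProbability ((Q.map lim).comap (Sum.inl : X → X ⊕ Unit)) := by
  rw [IsSubProbability, Measure.comap_apply _ Sum.inl_injective (fun _ hs => hs.inl_image) _ .univ]
  exact (measure_mono (Set.subset_univ _)).trans
    (by rwa [Measure.map_apply hlim .univ, Set.preimage_univ])

end Output

theorem Program.existsUnique_isParOutput {S : Type u} {σ : Schema S} {intensional : Set σ.Rel}
    {Dom : S → Type v} [∀ s, MeasurableSpace (Dom s)] (G : Program.{u, v, w} σ intensional Dom)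
    {P₀ : Measure G.Inst} (hP₀ : IsSubProbability P₀)
    (hQ : ∃! Q, IsMarkovLaw (parStep G.exRules) P₀ Q)
    {lim : (ℕ → G.Inst) → G.Inst ⊕ Unit} (hlim : Measurable lim) :
    ∃! Δ, IsSubProbability Δ ∧ G.IsParOutput lim P₀ Δ := by
  obtain ⟨Q, hQ, huniq⟩ := hQ
  refine ⟨_, ⟨isSubProbability_comap_map (hQ.measure_univ.trans_le hP₀) hlim, Q, hQ, rfl⟩, ?_⟩
  rintro Δ ⟨-, Q', hQ', rfl⟩
  rw [huniq Q' hQ']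

end GDatalog

theorem mainTheorem4 {S : Type u} {Dom : S → Type v} [∀ s, MeasurableSpace (Dom s)]
    [∀ s, StandardBorelSpace (Dom s)] (σ : GDatalog.Schema S) (intensional : Set σ.Rel)
    (G : GDatalog.Program.{u, v, w} σ intensional Dom)
    (hΨ : ∀ i, (G.prob i).dist.IsContinuous) :
    -- the transition probabilities of the parallel chase form a stochastic kernel
    ((∀ D, IsProbabilityMeasure (GDatalog.parStep G.exRules D)) ∧
      Measurable (GDatalog.parStep G.exRules)) ∧
    -- the maps from paths to limit instances are measurable
    (Measurable (GDatalog.limInst (GDatalog.paths G.exRules)) ∧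
      ∀ D ∈ G.inputs, Measurable (GDatalog.limInst (GDatalog.pathsFrom G.exRules D))) ∧
    -- single input instances
    (∀ D ∈ G.inputs,
      (∃! Q, GDatalog.IsMarkovLaw (GDatalog.parStep G.exRules) (Measure.dirac D) Q) ∧
      ∃! Δ, GDatalog.IsSubProbability Δ ∧
        G.IsParOutput (GDatalog.limInst (GDatalog.pathsFrom G.exRules D)) (Measure.dirac D) Δ) ∧
    -- sub-probabilistic input databases
    (∀ P : Measure G.inputs, GDatalog.IsSubProbability P →
      (∃! Q, GDatalog.IsMarkovLaw (GDatalog.parStep G.exRules) (P.map Subtype.val) Q) ∧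
      ∃! Δ, GDatalog.IsSubProbability Δ ∧
        G.IsParOutput (GDatalog.limInst (GDatalog.paths G.exRules)) (P.map Subtype.val) Δ) := by
  have hreg := G.regular_exRules hΨ
  have hprob := GDatalog.isProbabilityMeasure_parStep hreg
  have hκ := GDatalog.measurable_parStep hreg
  have hlim := GDatalog.measurable_limInst (GDatalog.measurableSet_paths hreg)
  have hlimFrom (D : G.Inst) :=
    GDatalog.measurable_limInst (GDatalog.measurableSet_pathsFrom hreg D)
  refine ⟨⟨hprob, hκ⟩, ⟨hlim, fun D _ => hlimFrom D⟩, fun D _ => ?_, fun P hP => ?_⟩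
  · have hQ := GDatalog.existsUnique_isMarkovLaw (P₀ := Measure.dirac D) hκ
    exact ⟨hQ, G.existsUnique_isParOutput prob_le_one hQ (hlimFrom D)⟩
  · have hP' : GDatalog.IsSubProbability (P.map Subtype.val) := by
      rwa [GDatalog.IsSubProbability, Measure.map_apply measurable_subtype_coe .univ]
    have : IsFiniteMeasure (P.map Subtype.val) := ⟨hP'.trans_lt ENNReal.one_lt_top⟩
    have hQ := GDatalog.existsUnique_isMarkovLaw (P₀ := P.map Subtype.val) hκ
    exact ⟨hQ, G.existsUnique_isParOutput hP' hQ hlim⟩
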